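/- An oriented graph is a finite directed graph without loops and with at most one edge between any two vertices; $\|H\|$ denotes the number of edges of $H$. A kernel is a bounded measurable function $U:[0,1]^2\to\mathbb{R}$, and $$t(H,U)=\int_{[0,1]^{V(H)}}\prod_{vw\in E(H)}U(x_v,x_w)\,\mathrm{d}x_{V(H)}.$$ A tournamenton is a non-negative kernel $W$ with $W(x,y)+W(y,x)=1$ for all $(x,y)\in[0,1]^2$. An oriented graph $H$ is quasirandom-forcing if every tournamenton $W$ with $t(H,W)=2^{-\|H\|}$ satisfies $W=1/2$ almost everywhere. For $m\ge 1$ let $Q_{2m}$ be the orientation of the path with $2m$ edges in which all edges are oriented from the central vertex towards the two end vertices. For $m\ge 2$ let $D_{2m}$ be the orientation of the cycle of length $2m$ obtained by choosing two opposite vertices and orienting all edges in the direction from one of them to the other. For an orientation $C$ of a cycle and $F\subseteq E(C)$ let $C\langle F\rangle$ be the spanning subgraph of $C$ with edge set $F$. For positive integers $n_1,\dots,n_k$ let $\alpha_C(2n_1,\dots,2n_k)$ be the number of sets $F\subseteq E(C)$ such that $C\langle F\rangle$ can be obtained from the disjoint union $Q_{2n_1}\cup\dots\cup Q_{2n_k}$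 by reversing an even number of edges and possibly adding isolated vertices, minus the number of sets $F\subseteq E(C)$ such that $C\langle F\rangle$ can be obtained from it by reversing an odd number of edges and possibly adding isolated vertices. If $C$ has even length $\ell$, let $\gamma_C=1$ if $C$ can be obtained from $D_\ell$ by reversing an even number of edges, and $\gamma_C=-1$ otherwise. Theorem. Let $C$ be an orientation of a cycle of even length $\ell\ge 4$. All sums below range over all integers $k\ge1$ and all integers $n_1,\dots,n_k$ satisfying the given conditions. The oriented cycle $C$ is quasirandom-forcing if $\gamma_C=1$, $$\frac{\alpha_C(2)}{2^{\ell-2}}+\sum_{\substack{n_1=\cdots=n_k=1\\ 3<k+2n_1+\cdots+2n_k\le\ell}}\frac{\min\{0,\alpha_C(2n_1,\ldots,2n_k)\}}{12^{k-1}\cdot 2^{\ell-2n_1-\cdots-2n_k}}\ge 0$$ and $$\frac{\alpha_C(4)}{2^{\ell-4}}+\sum_{\substack{1\le n_1\le\cdots\le n_k,\;2\le n_k\\ 5<k+2n_1+\cdots+2n_k\le\ell}}\frac{\min\{0,\alpha_C(2n_1,\ldots,2n_k)\}}{12^{k-1}\cdot\pi^{2n_1+\cdots+2n_k-2k-2}\cdot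 2^{\ell-2n_1-\cdots-2n_k}}\ge 0.$$ Similarly, $C$ is quasirandom-forcing if $\gamma_C=-1$, $$\frac{\alpha_C(2)}{2^{\ell-2}}+\sum_{\substack{n_1=\cdots=n_k=1\\ 3<k+2n_1+\cdots+2n_k\le\ell}}\frac{\max\{0,\alpha_C(2n_1,\ldots,2n_k)\}}{12^{k-1}\cdot 2^{\ell-2n_1-\cdots-2n_k}}\le 0$$ and $$\frac{\alpha_C(4)}{2^{\ell-4}}+\sum_{\substack{1\le n_1\le\cdots\le n_k,\;2\le n_k\\ 5<k+2n_1+\cdots+2n_k\le\ell}}\frac{\max\{0,\alpha_C(2n_1,\ldots,2n_k)\}}{12^{k-1}\cdot\pi^{2n_1+\cdots+2n_k-2k-2}\cdot 2^{\ell-2n_1-\cdots-2n_k}}\le 0.$$ -/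

import Mathlib

open MeasureTheory

/-- An oriented graph: each edge is an ordered pair `(u, v)`, and no pair of vertices is joined in
both directions (in particular there are no loops). -/
structure OrientedGraph (V : Type*) where
  Adj : V → V → Prop
  asymm : ∀ u v, Adj u v → ¬ Adj v u

namespace OrientedGraph

/-- The underlying undirected graph. -/
def underlying {V : Type*} (G : OrientedGraph V) : SimpleGraph V where
  Adj u v := G.Adj u v ∨ G.Adj v u
  symm := ⟨fun _ _ h => h.symm⟩
  loopless := ⟨fun u h => h.elim (fun h => G.asymm u u h h) (fun h => G.asymm u u h h)⟩

open Classical in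
/-- The set `E(G)` of (directed) edges. -/
noncomputable def edges {V : Type*} [Fintype V] (G : OrientedGraph V) : Finset (V × V) :=
  {e : V × V | G.Adj e.1 e.2}

/-- The spanning subgraph `G⟨F⟩`: same vertices, and edge set `F` (for `F ⊆ E(G)`). -/
def spanning {V : Type*} (G : OrientedGraph V) (F : Finset (V × V)) : OrientedGraph V where
  Adj u v := G.Adj u v ∧ (u, v) ∈ F
  asymm u v h h' := G.asymm u v h.1 h'.1

/-- The oriented graph obtained from `G` by reversing exactly the edges in `R`
(for `R ⊆ E(G)`). -/
def reverse {V : Type*} (G : OrientedGraph V) (R : Finset (V × V)) : OrientedGraph V where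
  Adj u v := (G.Adj u v ∧ (u, v) ∉ R) ∨ (G.Adj v u ∧ (v, u) ∈ R)
  asymm u v h h' := by
    rcases h with ⟨h, hR⟩ | ⟨h, hR⟩ <;> rcases h' with ⟨h', hR'⟩ | ⟨h', hR'⟩
    · exact G.asymm u v h h'
    · exact hR hR'
    · exact hR' hR
    · exact G.asymm u v h' h

/-- The disjoint union of a family of oriented graphs. -/
def disjUnion {ι : Type*} {V : ι → Type*} (G : ∀ i, OrientedGraph (V i)) :
    OrientedGraph (Σ i, V i) where
  Adj a b := ∃ i u v, a = ⟨i, u⟩ ∧ b = ⟨i, v⟩ ∧ (G i).Adj u v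
  asymm := by
    rintro a b ⟨i, u, v, rfl, rfl, h⟩ ⟨j, u', v', h1, h2, h'⟩
    obtain ⟨rfl, h1⟩ := Sigma.mk.inj_iff.mp h1
    obtain ⟨_, h2⟩ := Sigma.mk.inj_iff.mp h2
    obtain rfl := eq_of_heq h1
    obtain rfl := eq_of_heq h2
    exact (G i).asymm _ _ h h'

/-- `H` is isomorphic to `G`. -/
def IsIso {A B : Type*} (G : OrientedGraph A) (H : OrientedGraph B) : Prop :=
  ∃ φ : A ≃ B, ∀ a b, H.Adj (φ a) (φ b) ↔ G.Adj a b

/-- `H` is isomorphic to `G` with (possibly) some isolated vertices added: after identifying the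
vertices of `G` with some of the vertices of `H`, the two graphs have the same edges. -/
def IsIsoAddIsolated {A B : Type*} (G : OrientedGraph A) (H : OrientedGraph B) : Prop :=
  ∃ φ : A ↪ B, ∀ u v, H.Adj u v ↔ ∃ a b, φ a = u ∧ φ b = v ∧ G.Adj a b

/-- `C` is an orientation of a cycle of length `ℓ`. -/
def IsCycleOrientation {V : Type*} (C : OrientedGraph V) (ℓ : ℕ) : Prop :=
  3 ≤ ℓ ∧ Nonempty (C.underlying ≃g SimpleGraph.cycleGraph ℓ)

/-- `Q_{2m}`: the path with `2m` edges on the vertices `0, 1, …, 2m`, with all edges oriented from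
the central vertex `m` towards the two end vertices. -/
def pathQ (m : ℕ) : OrientedGraph (Fin (2 * m + 1)) where
  Adj a b := (m ≤ a.val ∧ b.val = a.val + 1) ∨ (a.val ≤ m ∧ a.val = b.val + 1)
  asymm a b h h' := by omega

/-- `D_{2k}`: the cycle on the vertices `0, 1, …, 2k-1` formed by the two directed paths
`0 → 1 → ⋯ → k` and `0 → 2k-1 → 2k-2 → ⋯ → k`. -/
def cycleD (k : ℕ) : OrientedGraph (Fin (2 * k)) where
  Adj a b := (b.val = a.val + 1 ∧ b.val ≤ k) ∨ (a.val = b.val + 1 ∧ k ≤ b.val) ∨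
    (a.val = 0 ∧ b.val + 1 = 2 * k)
  asymm a b h h' := by omega

open Classical in
/-- `alpha C n` is `α_C(2n_1, …, 2n_k)`: the number of sets `F ⊆ E(C)` such that `C⟨F⟩` can be
obtained from `Q_{2n_1} ∪ ⋯ ∪ Q_{2n_k}` by reversing an even number of edges and possibly adding
isolated vertices, minus the number of those for which an odd number of edges is reversed. -/
noncomputable def alpha {V : Type*} [Fintype V] (C : OrientedGraph V) {k : ℕ} (n : Fin k → ℕ) :
    ℤ :=
  (({F ∈ C.edges.powerset | ∃ R ⊆ (disjUnion fun i => pathQ (n i)).edges, Even R.card ∧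
      IsIsoAddIsolated ((disjUnion fun i => pathQ (n i)).reverse R) (C.spanning F)}).card : ℤ) -
  (({F ∈ C.edges.powerset | ∃ R ⊆ (disjUnion fun i => pathQ (n i)).edges, Odd R.card ∧
      IsIsoAddIsolated ((disjUnion fun i => pathQ (n i)).reverse R) (C.spanning F)}).card : ℤ)

open Classical in
/-- `γ_C` for an orientation `C` of a cycle of even length `ℓ`: it is `1` if `C` can be obtained
from `D_ℓ` by reversing an even number of edges, and `-1` otherwise. -/
noncomputable def gamma {V : Type*} (C : OrientedGraph V) (ℓ : ℕ) : ℤ :=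
  if ∃ R ⊆ (cycleD (ℓ / 2)).edges, Even R.card ∧ IsIso ((cycleD (ℓ / 2)).reverse R) C
  then 1 else -1

open Classical in
/-- The tuples `1 ≤ n_1 ≤ ⋯ ≤ n_k` with `k + 2n_1 + ⋯ + 2n_k ≤ ℓ`. (The bound `n_i ≤ ℓ` follows
from the last condition.) -/
noncomputable def tuples (ℓ k : ℕ) : Finset (Fin k → ℕ) :=
  {n ∈ Fintype.piFinset fun _ : Fin k => Finset.Icc 1 ℓ |
    Monotone n ∧ k + ∑ i, 2 * n i ≤ ℓ}

/-- A kernel: a bounded measurable function from `[0,1]²` to `ℝ`. -/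
structure IsKernel (U : unitInterval × unitInterval → ℝ) : Prop where
  measurable : Measurable U
  bounded : ∃ M : ℝ, ∀ p, |U p| ≤ M

/-- A tournamenton: a non-negative kernel `W` with `W(x,y) + W(y,x) = 1` for all `x, y`. -/
structure IsTournamenton (W : unitInterval × unitInterval → ℝ) : Prop extends IsKernel W where
  nonneg : ∀ p, 0 ≤ W p
  add_swap : ∀ x y, W (x, y) + W (y, x) = 1

/-- The homomorphism density `t(H, U)` of an oriented graph `H` in a kernel `U`. -/
noncomputable def density {V : Type*} [Fintype V] (H : OrientedGraph V)
    (U : unitInterval × unitInterval → ℝ) : ℝ :=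
  ∫ x : V → unitInterval, ∏ e ∈ H.edges, U (x e.1, x e.2)

/-- `H` is quasirandom-forcing: every tournamenton `W` such that `t(H, W) = 2^{-‖H‖}` is equal to
`1/2` almost everywhere, where `‖H‖` is the number of edges of `H`. -/
def QuasirandomForcing {V : Type*} [Fintype V] (H : OrientedGraph V) : Prop :=
  ∀ W : unitInterval × unitInterval → ℝ, IsTournamenton W →
    H.density W = 1 / 2 ^ H.edges.card → W =ᵐ[volume] fun _ => 1 / 2

end OrientedGraph

/-! Write W = 1/2 + U with U skew-symmetric and |U| ≤ 1/2, let T be the integral operator with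
kernel U, and put q_m = ‖T^m 1‖² (`pathNorm`). Expanding the product over the edges of C gives
t(C,W) as a sum of t(C⟨F⟩,U) 2^{-(ℓ-|F|)} over edge sets F. Reversing an edge changes the sign of
the density in U, so only the undirected shape of C⟨F⟩ and a parity matter. A proper F is a union of
paths. Since T* = -T, an odd path has density 0 and Q_{2m} has density q_m. The full cycle
contributes γ_C t(D_ℓ,U), where t(D_ℓ,U) is a squared L² norm of a power of U. Hence
(`IsCycleOrientation.density_expansion`) t(C,W) - 2^{-ℓ} equals γ_C t(D_ℓ,U) plus the sum of
α_C(2n_1,…,2n_k) ∏ q_{n_i} / 2^{ℓ-2n_1-⋯-2n_k}.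

Two estimates control the products: q_1 ≤ 1/12, from a pointwise inequality on triples of vertices,
and q_{m+j} ≤ q_m / π^{2j}, because T has operator norm at most 1/π. The latter follows from the
Fourier series of |sin|, whose only positive coefficient is the constant 2/π. Terms with all n_i = 1
are compared with q_1 and all others with q_2, so for γ_C = 1 the path sum is at least q_1 times the
first hypothesis plus q_2 times the second (`sum_coeff_nonneg`). It is therefore nonnegative; γ_C =
-1 is the same after a change of sign.

If t(C,W) = 2^{-ℓ}, two nonnegative quantities add up to 0, so t(D_ℓ,U) = 0. A power of U then
vanishes, and skew-symmetry forces U = 0 almost everywhere. -/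

/-! ### The Fourier series of |sin| -/

theorem integral_abs_sin_mul_exp (n : ℤ) :
    ∫ t in (0 : ℝ)..Real.pi, Complex.exp (-(2 * n * Complex.I * t)) * (Real.sin t : ℂ) =
      2 / (1 - 4 * (n : ℂ) ^ 2) := by
  have hne : (1 - 4 * (n : ℂ) ^ 2) ≠ 0 := by
    intro h
    have h2 : (1 - 4 * n ^ 2 : ℤ) = 0 := by exact_mod_cast h
    omega
  -- The antiderivative comes from integrating by parts twice.
  have key : ∀ t : ℝ, HasDerivAt (fun t : ℝ => -(Complex.exp (-(2 * n * Complex.I * t)) *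
      (Complex.cos t + 2 * n * Complex.I * Complex.sin t)) / (1 - 4 * (n : ℂ) ^ 2))
      (Complex.exp (-(2 * n * Complex.I * t)) * (Real.sin t : ℂ)) t := by
    intro t
    have h1 : HasDerivAt (fun z : ℂ => -(Complex.exp (-(2 * n * Complex.I * z)) *
        (Complex.cos z + 2 * n * Complex.I * Complex.sin z)) / (1 - 4 * (n : ℂ) ^ 2))
        (Complex.exp (-(2 * n * Complex.I * t)) * Complex.sin t) (t : ℂ) := by
      have he : HasDerivAt (fun z : ℂ => Complex.exp (-(2 * n * Complex.I * z)))
          (Complex.exp (-(2 * n * Complex.I * t)) * (-(2 * n * Complex.I))) (t : ℂ) := by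
        have := ((hasDerivAt_id (t : ℂ)).const_mul (2 * n * Complex.I)).neg.cexp
        simpa using this
      have hc := (Complex.hasDerivAt_cos (t : ℂ)).add
        ((Complex.hasDerivAt_sin (t : ℂ)).const_mul (2 * n * Complex.I))
      refine (((he.mul hc).neg).div_const _).congr_deriv ?_
      simp only [Pi.add_apply]
      rw [div_eq_iff hne]
      linear_combination (4 * (n : ℂ) ^ 2 * Complex.exp (-(2 * n * Complex.I * t)) *
        Complex.sin t) * Complex.I_sq
    have := h1.comp_ofReal
    rwa [← Complex.ofReal_sin] at this
  rw [intervalIntegral.integral_eq_sub_of_hasDerivAt (fun t _ => key t)]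
  · have : Complex.exp (-(2 * n * Complex.I * (Real.pi : ℝ))) = 1 := by
      rw [Complex.exp_eq_one_iff]
      exact ⟨-n, by push_cast; ring⟩
    rw [this]
    simp
    ring
  · apply Continuous.intervalIntegrable
    fun_prop

/-- |sin| has period π and its coefficients decay like 1/n², so the series converges pointwise. What
matters later is the sign: every coefficient with n ≠ 0 is negative. -/
theorem hasSum_abs_sin (t : ℝ) :
    HasSum (fun n : ℤ => ((2 / Real.pi) / (1 - 4 * (n : ℝ) ^ 2) : ℝ) *
      Complex.exp (2 * n * Complex.I * t)) ((|Real.sin t| : ℝ) : ℂ) := by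
  have : Fact (0 < Real.pi) := ⟨Real.pi_pos⟩
  have hper : Function.Periodic (fun t : ℝ => ((|Real.sin t| : ℝ) : ℂ)) Real.pi := by
    intro t
    simp [Real.sin_add_pi]
  let f : C(AddCircle Real.pi, ℂ) := ⟨hper.lift, by
    refine continuous_coinduced_dom.mpr ?_
    show Continuous fun t : ℝ => ((|Real.sin t| : ℝ) : ℂ)
    fun_prop⟩
  have hcoeff : ∀ n : ℤ, fourierCoeff f n =
      (((2 / Real.pi) / (1 - 4 * (n : ℝ) ^ 2) : ℝ) : ℂ) := by
    intro n
    rw [fourierCoeff_eq_intervalIntegral f n 0, zero_add]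
    have : ∫ x in (0 : ℝ)..Real.pi, fourier (-n) (x : AddCircle Real.pi) • f x =
        ∫ t in (0 : ℝ)..Real.pi, Complex.exp (-(2 * n * Complex.I * t)) * (Real.sin t : ℂ) := by
      apply intervalIntegral.integral_congr
      intro x hx
      rw [Set.uIcc_of_le Real.pi_pos.le] at hx
      have h0 : |Real.sin x| = Real.sin x := abs_of_nonneg (Real.sin_nonneg_of_mem_Icc hx)
      have hf : f (x : AddCircle Real.pi) = ((|Real.sin x| : ℝ) : ℂ) := rfl
      simp only [hf, h0, fourier_coe_apply, smul_eq_mul]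
      congr 2
      have : (Real.pi : ℂ) ≠ 0 := by exact_mod_cast Real.pi_ne_zero
      push_cast
      field_simp
    rw [this, integral_abs_sin_mul_exp, Complex.real_smul]
    push_cast
    ring
  have hsum : Summable (fourierCoeff f) := by
    have h2 : Summable fun n : ℤ => (2 / Real.pi) * (1 / (n : ℝ) ^ 2) :=
      (Real.summable_one_div_int_pow.mpr one_lt_two).mul_left _
    -- The comparison 1/(4n² - 1) ≤ 1/n² needs n ≠ 0, whence the cofinite filter.
    refine Summable.of_norm_bounded_eventually h2 ?_
    have : {n : ℤ | n ≠ 0} ∈ Filter.cofinite :=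
      (Set.finite_singleton (0 : ℤ)).compl_mem_cofinite
    filter_upwards [this] with n hn
    have hn1 : (1 : ℝ) ≤ (n : ℝ) ^ 2 := by
      have : (1 : ℤ) ≤ n ^ 2 := by
        have := sq_nonneg n
        have h3 : n ^ 2 ≠ 0 := pow_ne_zero 2 hn
        omega
      exact_mod_cast this
    have hp := Real.pi_pos
    rw [hcoeff, Complex.norm_real, Real.norm_eq_abs, abs_div, abs_of_pos (by positivity),
      div_eq_mul_one_div (2 / Real.pi)]
    refine mul_le_mul_of_nonneg_left ?_ (by positivity)
    rw [abs_of_nonpos (by linarith)]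
    exact one_div_le_one_div_of_le (by positivity) (by linarith)
  have := has_pointwise_sum_fourier_series_of_summable hsum (t : AddCircle Real.pi)
  have h2 : ∀ n : ℤ, fourierCoeff f n • fourier n (t : AddCircle Real.pi) =
      ((2 / Real.pi) / (1 - 4 * (n : ℝ) ^ 2) : ℝ) * Complex.exp (2 * n * Complex.I * t) := by
    intro n
    rw [hcoeff, fourier_coe_apply, smul_eq_mul]
    congr 2
    have : (Real.pi : ℂ) ≠ 0 := by exact_mod_cast Real.pi_ne_zero
    field_simp
  simp only [h2] at this
  exact this

/-! ### Bounded measurable functions -/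

/-- A bounded measurable real function. -/
structure BddMeasurable {X : Type*} [MeasurableSpace X] (f : X → ℝ) : Prop where
  measurable : Measurable f
  bounded : ∃ M : ℝ, ∀ x, |f x| ≤ M

namespace BddMeasurable

variable {X Y : Type*} [MeasurableSpace X] [MeasurableSpace Y] {f g : X → ℝ}

theorem const (c : ℝ) : BddMeasurable fun _ : X => c :=
  ⟨measurable_const, |c|, fun _ => le_rfl⟩

theorem comp (hf : BddMeasurable f) {φ : Y → X} (hφ : Measurable φ) :
    BddMeasurable fun y => f (φ y) :=
  ⟨hf.measurable.comp hφ, hf.bounded.imp fun _ h y => h (φ y)⟩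

theorem mul (hf : BddMeasurable f) (hg : BddMeasurable g) : BddMeasurable fun x => f x * g x := by
  obtain ⟨M, hM⟩ := hf.bounded
  obtain ⟨N, hN⟩ := hg.bounded
  refine ⟨hf.measurable.mul hg.measurable, M * N, fun x => ?_⟩
  rw [abs_mul]
  exact mul_le_mul (hM x) (hN x) (abs_nonneg _) ((abs_nonneg _).trans (hM x))

theorem add (hf : BddMeasurable f) (hg : BddMeasurable g) : BddMeasurable fun x => f x + g x := by
  obtain ⟨M, hM⟩ := hf.bounded
  obtain ⟨N, hN⟩ := hg.bounded
  exact ⟨hf.measurable.add hg.measurable, M + N, fun x =>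
    (abs_add_le _ _).trans (add_le_add (hM x) (hN x))⟩

theorem neg (hf : BddMeasurable f) : BddMeasurable fun x => -f x :=
  ⟨hf.measurable.neg, hf.bounded.imp fun _ h x => by rw [abs_neg]; exact h x⟩

theorem sub (hf : BddMeasurable f) (hg : BddMeasurable g) : BddMeasurable fun x => f x - g x := by
  simpa only [sub_eq_add_neg] using hf.add hg.neg

theorem abs (hf : BddMeasurable f) : BddMeasurable fun x => |f x| :=
  ⟨continuous_abs.measurable.comp hf.measurable, hf.bounded.imp fun _ h x => by
    rw [abs_abs]; exact h x⟩

theorem pow (hf : BddMeasurable f) (n : ℕ) : BddMeasurable fun x => f x ^ n := by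
  induction n with
  | zero => simpa using const 1
  | succ n ih => simpa only [pow_succ] using ih.mul hf

theorem prod {ι : Type*} (s : Finset ι) {f : ι → X → ℝ} (hf : ∀ i ∈ s, BddMeasurable (f i)) :
    BddMeasurable fun x => ∏ i ∈ s, f i x := by
  classical
  induction s using Finset.induction_on with
  | empty => simpa using const 1
  | insert a s ha ih =>
    simp only [Finset.prod_insert ha]
    exact (hf a (Finset.mem_insert_self a s)).mul
      (ih fun i hi => hf i (Finset.mem_insert_of_mem hi))

theorem integrable (hf : BddMeasurable f) (μ : Measure X) [IsFiniteMeasure μ] :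
    Integrable f μ := by
  obtain ⟨M, hM⟩ := hf.bounded
  exact Integrable.of_bound hf.measurable.aestronglyMeasurable M (ae_of_all _ hM)

theorem integral_right {f : X × Y → ℝ} (hf : BddMeasurable f) (μ : Measure Y)
    [IsProbabilityMeasure μ] : BddMeasurable fun x => ∫ y, f (x, y) ∂μ := by
  obtain ⟨M, hM⟩ := hf.bounded
  refine ⟨(hf.measurable.stronglyMeasurable.integral_prod_right' (ν := μ)).measurable, M,
    fun x => ?_⟩
  have := norm_integral_le_of_norm_le_const (μ := μ) (f := fun y => f (x, y)) (C := M)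
    (ae_of_all _ fun y => hM (x, y))
  simpa using this

end BddMeasurable

/-! ### An integral inequality for planar vectors -/

section Planar

variable {X : Type*} [MeasurableSpace X] (μ : Measure X) [IsProbabilityMeasure μ]

/-- In the Fourier expansion of |sin(θ(y) - θ(x))|, the n-th term integrates to the n-th coefficient
times |∫ r e^{2inθ}|². Only n = 0 has a positive coefficient, so dropping the rest gives an upper
bound. -/
theorem integral_mul_abs_sin_sub_le {r θ : X → ℝ} (hr : BddMeasurable r) (hr0 : ∀ x, 0 ≤ r x)
    (hθ : Measurable θ) :
    ∫ p, r p.1 * r p.2 * |Real.sin (θ p.2 - θ p.1)| ∂(μ.prod μ) ≤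
      2 / Real.pi * (∫ x, r x ∂μ) ^ 2 := by
  set c : ℤ → ℝ := fun n => (2 / Real.pi) / (1 - 4 * (n : ℝ) ^ 2) with hc
  set e : ℤ → X → ℂ := fun n x => r x * Complex.exp (2 * n * Complex.I * θ x) with he
  obtain ⟨M, hM⟩ := hr.bounded
  have hnorm : ∀ n x, ‖e n x‖ = r x := by
    intro n x
    have : (2 * n * Complex.I * θ x : ℂ) = ((2 * n * θ x : ℝ) : ℂ) * Complex.I := by
      push_cast; ring
    simp only [he]
    rw [norm_mul, this, Complex.norm_exp_ofReal_mul_I, mul_one, Complex.norm_real,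
      Real.norm_of_nonneg (hr0 x)]
  have hmeas : ∀ n, Measurable (e n) := by
    intro n
    have := hr.measurable
    fun_prop
  have hint : ∀ n, Integrable (e n) μ := fun n =>
    Integrable.of_bound (hmeas n).aestronglyMeasurable M
      (ae_of_all _ fun x => by rw [hnorm]; exact (le_abs_self _).trans (hM x))
  have hconj : ∀ n x, e (-n) x = (starRingEnd ℂ) (e n x) := by
    intro n x
    simp [he, ← Complex.exp_conj, Complex.conj_ofReal, map_ofNat]
  set F : ℤ → X × X → ℂ := fun n p => c n * (e (-n) p.1 * e n p.2) with hF
  have hFint : ∀ n, Integrable (F n) (μ.prod μ) := fun n =>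
    ((hint (-n)).mul_prod (hint n)).const_mul _
  have hFval : ∀ n, ∫ p, F n p ∂(μ.prod μ) = ((c n * ‖∫ x, e n x ∂μ‖ ^ 2 : ℝ) : ℂ) := by
    intro n
    simp only [hF]
    rw [integral_const_mul, integral_prod_mul]
    have : ∫ x, e (-n) x ∂μ = (starRingEnd ℂ) (∫ x, e n x ∂μ) := by
      rw [← integral_conj]
      exact integral_congr_ae (ae_of_all _ fun x => hconj n x)
    rw [this, Complex.conj_mul']
    push_cast
    ring
  have hFsum : ∀ p, HasSum (fun n => F n p)
      ((r p.1 * r p.2 * |Real.sin (θ p.2 - θ p.1)| : ℝ) : ℂ) := by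
    intro p
    have := (hasSum_abs_sin (θ p.2 - θ p.1)).mul_left ((r p.1 * r p.2 : ℝ) : ℂ)
    rw [← Complex.ofReal_mul] at this
    suffices h : ∀ n, F n p = _ by simp only [h]; exact this
    intro n
    simp only [hF, he, hc]
    have h2 : (2 * (n : ℂ) * Complex.I * ((θ p.2 - θ p.1 : ℝ) : ℂ)) =
      2 * ((-n : ℤ) : ℂ) * Complex.I * θ p.1 + 2 * n * Complex.I * θ p.2 := by push_cast; ring
    rw [h2, Complex.exp_add]
    push_cast
    ring
  have hcsum : Summable fun n => |c n| := by
    have := (hasSum_abs_sin 0).summable.norm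
    refine this.congr fun n => ?_
    simp only [hc, Complex.ofReal_zero, mul_zero, Complex.exp_zero, mul_one, Complex.norm_real,
      Real.norm_eq_abs]
  have hnormint : Summable fun n => ∫ p, ‖F n p‖ ∂(μ.prod μ) := by
    have : ∀ n, ∫ p, ‖F n p‖ ∂(μ.prod μ) = |c n| * ((∫ x, r x ∂μ) * ∫ x, r x ∂μ) := by
      intro n
      simp only [hF, norm_mul, hnorm, Complex.norm_real, Real.norm_eq_abs]
      rw [integral_const_mul, integral_prod_mul]
    simp only [this]
    exact hcsum.mul_right _
  have key := hasSum_integral_of_summable_integral_norm hFint hnormint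
  simp only [hFval, (hFsum _).tsum_eq] at key
  rw [integral_complex_ofReal, Complex.hasSum_ofReal] at key
  refine hasSum_le (fun n => ?_) key (hasSum_ite_eq (0 : ℤ) (2 / Real.pi * (∫ x, r x ∂μ) ^ 2))
  split_ifs with h
  · subst h
    simp only [hc, he]
    rw [← sq_abs (∫ x, r x ∂μ), ← Real.norm_eq_abs, ← Complex.norm_real, ← integral_complex_ofReal]
    simp
  · refine mul_nonpos_of_nonpos_of_nonneg ?_ (by positivity)
    refine div_nonpos_of_nonneg_of_nonpos (by positivity) ?_
    have : (1 : ℤ) ≤ n ^ 2 := by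
      have := sq_nonneg n
      have h3 : n ^ 2 ≠ 0 := pow_ne_zero 2 h
      omega
    have : (1 : ℝ) ≤ (n : ℝ) ^ 2 := by exact_mod_cast this
    linarith

theorem sq_integral_le {r : X → ℝ} (hr : BddMeasurable r) :
    (∫ x, r x ∂μ) ^ 2 ≤ ∫ x, r x ^ 2 ∂μ := by
  have h : 0 ≤ ∫ x, (r x - ∫ y, r y ∂μ) ^ 2 ∂μ := integral_nonneg fun x => sq_nonneg _
  have h2 : ∀ x, (r x - ∫ y, r y ∂μ) ^ 2 = r x ^ 2 - 2 * (∫ y, r y ∂μ) * r x +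
      (∫ y, r y ∂μ) ^ 2 := fun x => by ring
  simp only [h2] at h
  rw [integral_add (((hr.pow 2).sub ((BddMeasurable.const _).mul hr)).integrable μ)
    ((BddMeasurable.const _).integrable μ), integral_sub ((hr.pow 2).integrable μ)
    (((BddMeasurable.const _).mul hr).integrable μ), integral_const_mul] at h
  simp at h
  nlinarith

/-- In polar coordinates for the vector (f, g), the cross product of two such vectors is r r' sin(θ'
- θ); the previous bound and Cauchy–Schwarz finish. -/
theorem integral_abs_cross_le {f g : X → ℝ} (hf : BddMeasurable f) (hg : BddMeasurable g) :
    ∫ p, |f p.1 * g p.2 - f p.2 * g p.1| ∂(μ.prod μ) ≤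
      2 / Real.pi * ∫ x, (f x ^ 2 + g x ^ 2) ∂μ := by
  set z : X → ℂ := fun x => ⟨f x, g x⟩ with hz
  have hzm : Measurable z := by
    have h1 := hf.measurable
    have h2 := hg.measurable
    have : z = fun x => (f x : ℂ) + g x * Complex.I := by
      funext x
      apply Complex.ext <;> simp [hz]
    rw [this]
    fun_prop
  set r : X → ℝ := fun x => ‖z x‖ with hr
  set θ : X → ℝ := fun x => (z x).arg with hθ
  have hr2 : ∀ x, r x ^ 2 = f x ^ 2 + g x ^ 2 := by
    intro x
    simp only [hr, hz]
    rw [Complex.sq_norm, Complex.normSq_mk]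
    ring
  have hfr : ∀ x, f x = r x * Real.cos (θ x) := fun x => (Complex.norm_mul_cos_arg (z x)).symm
  have hgr : ∀ x, g x = r x * Real.sin (θ x) := fun x => (Complex.norm_mul_sin_arg (z x)).symm
  have hr0 : ∀ x, 0 ≤ r x := fun x => norm_nonneg _
  have hrb : BddMeasurable r := by
    obtain ⟨M, hM⟩ := hf.bounded
    obtain ⟨N, hN⟩ := hg.bounded
    refine ⟨hzm.norm, M + N, fun x => ?_⟩
    rw [abs_of_nonneg (hr0 x)]
    exact (Complex.norm_le_abs_re_add_abs_im _).trans (add_le_add (hM x) (hN x))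
  have h1 : ∀ p : X × X, |f p.1 * g p.2 - f p.2 * g p.1| =
      r p.1 * r p.2 * |Real.sin (θ p.2 - θ p.1)| := by
    intro p
    rw [hfr p.1, hfr p.2, hgr p.1, hgr p.2, Real.sin_sub]
    conv_rhs => rw [← abs_of_nonneg (mul_nonneg (hr0 p.1) (hr0 p.2)), ← abs_mul]
    congr 1
    ring
  simp only [h1, ← hr2]
  refine (integral_mul_abs_sin_sub_le μ hrb hr0 (Complex.measurable_arg.comp hzm)).trans ?_
  exact mul_le_mul_of_nonneg_left (sq_integral_le μ hrb) (by positivity)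

end Planar

/-! ### Integral operators with skew-symmetric kernels -/

section KernelOp

variable {X : Type*} [MeasurableSpace X] (μ : Measure X) {U : X × X → ℝ} {f g : X → ℝ}

/-- The integral operator with kernel `U`. -/
noncomputable def kernelOp (U : X × X → ℝ) (f : X → ℝ) (x : X) : ℝ :=
  ∫ y, U (x, y) * f y ∂μ

/-- A bounded measurable skew-symmetric kernel. -/
structure IsSkewKernel (U : X × X → ℝ) : Prop extends BddMeasurable U where
  skew : ∀ x y, U (x, y) = -U (y, x)

variable [IsProbabilityMeasure μ]

theorem BddMeasurable.kernelOp (hU : BddMeasurable U) (hf : BddMeasurable f) :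
    BddMeasurable (kernelOp μ U f) :=
  (hU.mul (hf.comp measurable_snd)).integral_right μ

theorem BddMeasurable.kernelOp_iterate (hU : BddMeasurable U) (hf : BddMeasurable f) (n : ℕ) :
    BddMeasurable ((_root_.kernelOp μ U)^[n] f) := by
  induction n with
  | zero => exact hf
  | succ n ih => rw [Function.iterate_succ_apply']; exact hU.kernelOp μ ih

theorem integral_mul_kernelOp (hU : BddMeasurable U) (hf : BddMeasurable f)
    (hg : BddMeasurable g) :
    ∫ x, f x * kernelOp μ U g x ∂μ = ∫ p, U p * (f p.1 * g p.2) ∂(μ.prod μ) := by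
  rw [integral_prod _ ((hU.mul ((hf.comp measurable_fst).mul
    (hg.comp measurable_snd))).integrable _)]
  refine integral_congr_ae (ae_of_all _ fun x => ?_)
  simp only [kernelOp]
  rw [← integral_const_mul]
  exact integral_congr_ae (ae_of_all _ fun y => by ring)

variable {μ}

namespace IsSkewKernel

theorem integral_prod_swap (hU : IsSkewKernel U) :
    ∫ p, U p * (f p.1 * g p.2) ∂(μ.prod μ) = -∫ p, U p * (g p.1 * f p.2) ∂(μ.prod μ) := by
  rw [← MeasureTheory.integral_prod_swap, ← integral_neg]
  refine integral_congr_ae (ae_of_all _ fun p => ?_)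
  simp only [Prod.fst_swap, Prod.snd_swap]
  rw [show p.swap = (p.2, p.1) from rfl, hU.skew p.2 p.1]
  ring

/-- The adjoint of T is -T. All signs of path and cycle densities come from this. -/
theorem integral_mul_kernelOp_left (hU : IsSkewKernel U) (hf : BddMeasurable f)
    (hg : BddMeasurable g) :
    ∫ x, f x * kernelOp μ U g x ∂μ = -∫ x, kernelOp μ U f x * g x ∂μ := by
  simp only [mul_comm (kernelOp μ U f _)]
  rw [integral_mul_kernelOp μ hU.toBddMeasurable hf hg,
    integral_mul_kernelOp μ hU.toBddMeasurable hg hf, hU.integral_prod_swap]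

theorem integral_mul_kernelOp_iterate (hU : IsSkewKernel U) (hf : BddMeasurable f)
    (hg : BddMeasurable g) (n : ℕ) :
    ∫ x, f x * (kernelOp μ U)^[n] g x ∂μ = (-1) ^ n * ∫ x, (kernelOp μ U)^[n] f x * g x ∂μ := by
  induction n generalizing g with
  | zero => simp
  | succ n ih =>
    rw [Function.iterate_succ_apply, ih (hU.toBddMeasurable.kernelOp μ hg),
      hU.integral_mul_kernelOp_left (hU.toBddMeasurable.kernelOp_iterate μ hf n) hg,
      Function.iterate_succ_apply', pow_succ]
    ring

theorem integral_mul_kernelOp_iterate_even (hU : IsSkewKernel U) (hf : BddMeasurable f) (m : ℕ) :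
    ∫ x, f x * (kernelOp μ U)^[2 * m] f x ∂μ =
      (-1) ^ m * ∫ x, (kernelOp μ U)^[m] f x ^ 2 ∂μ := by
  rw [two_mul, Function.iterate_add_apply, hU.integral_mul_kernelOp_iterate hf
    (hU.toBddMeasurable.kernelOp_iterate μ hf m)]
  simp only [sq]

/-- An odd power of a skew-adjoint operator is skew-adjoint, so its quadratic form equals its own
negative. -/
theorem integral_mul_kernelOp_iterate_odd (hU : IsSkewKernel U) (hf : BddMeasurable f) {n : ℕ}
    (hn : Odd n) : ∫ x, f x * (kernelOp μ U)^[n] f x ∂μ = 0 := by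
  have := hU.integral_mul_kernelOp_iterate (μ := μ) hf hf n
  rw [hn.neg_one_pow] at this
  simp only [mul_comm _ (f _)] at this
  linarith

/-- The operator norm of a skew-symmetric kernel with entries in `[-1/2, 1/2]` is at most `1/π`. -/
theorem integral_kernelOp_sq_le (hU : IsSkewKernel U) (hU2 : ∀ p, |U p| ≤ 1 / 2)
    (hf : BddMeasurable f) :
    ∫ x, kernelOp μ U f x ^ 2 ∂μ ≤ (∫ x, f x ^ 2 ∂μ) / Real.pi ^ 2 := by
  have hπ := Real.pi_pos
  have hs : √Real.pi ^ 2 = Real.pi := Real.sq_sqrt hπ.le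
  have hs0 : √Real.pi ≠ 0 := (Real.sqrt_pos.mpr hπ).ne'
  set g := kernelOp μ U f with hg
  have hgb : BddMeasurable g := hU.toBddMeasurable.kernelOp μ hf
  have h1 : ∫ x, g x ^ 2 ∂μ = ∫ p, U p * (g p.1 * f p.2) ∂(μ.prod μ) := by
    rw [← integral_mul_kernelOp μ hU.toBddMeasurable hgb hf]
    simp only [sq, ← hg]
  have hb1 : BddMeasurable fun p : X × X => U p * (g p.1 * f p.2) :=
    hU.toBddMeasurable.mul ((hgb.comp measurable_fst).mul (hf.comp measurable_snd))
  have hb2 : BddMeasurable fun p : X × X => U p * (f p.1 * g p.2) :=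
    hU.toBddMeasurable.mul ((hf.comp measurable_fst).mul (hgb.comp measurable_snd))
  have h2 : 2 * ∫ x, g x ^ 2 ∂μ =
      ∫ p, (U p * (g p.1 * f p.2) - U p * (f p.1 * g p.2)) ∂(μ.prod μ) := by
    rw [integral_sub (hb1.integrable _) (hb2.integrable _), hU.integral_prod_swap (f := f), h1]
    ring
  -- The factors (√π)⁻¹ and √π cancel in the cross product. They balance the planar inequality so
  -- that its right side becomes ‖f‖²/π² + ‖g‖², and the last term is absorbed by 2‖g‖².
  have h3 : ∫ p, (U p * (g p.1 * f p.2) - U p * (f p.1 * g p.2)) ∂(μ.prod μ) ≤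
      ∫ p, (1 / 2) * |(√Real.pi)⁻¹ * f p.1 * (√Real.pi * g p.2) -
        (√Real.pi)⁻¹ * f p.2 * (√Real.pi * g p.1)| ∂(μ.prod μ) := by
    refine integral_mono ((hb1.sub hb2).integrable _) (BddMeasurable.integrable ?_ _) fun p => ?_
    · have := ((hf.comp (measurable_fst (β := X))).mul (hgb.comp (measurable_snd (α := X)))).sub
        ((hf.comp (measurable_snd (α := X))).mul (hgb.comp (measurable_fst (β := X))))
      refine (BddMeasurable.const (1 / 2)).mul ?_
      convert this.abs using 3 with p
      field_simp
    · have : (√Real.pi)⁻¹ * f p.1 * (√Real.pi * g p.2) -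
        (√Real.pi)⁻¹ * f p.2 * (√Real.pi * g p.1) = f p.1 * g p.2 - f p.2 * g p.1 := by
        field_simp
      simp only [this]
      calc U p * (g p.1 * f p.2) - U p * (f p.1 * g p.2)
          = -(U p * (f p.1 * g p.2 - f p.2 * g p.1)) := by ring
        _ ≤ |U p * (f p.1 * g p.2 - f p.2 * g p.1)| := neg_le_abs _
        _ ≤ _ := by
          rw [abs_mul]
          exact mul_le_mul_of_nonneg_right (hU2 p) (abs_nonneg _)
  have h4 := integral_abs_cross_le μ ((BddMeasurable.const (√Real.pi)⁻¹).mul hf)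
    ((BddMeasurable.const √Real.pi).mul hgb)
  rw [integral_const_mul] at h3
  simp only [mul_pow, inv_pow, hs] at h4
  rw [integral_add (((BddMeasurable.const _).mul (hf.pow 2)).integrable _)
    (((BddMeasurable.const _).mul (hgb.pow 2)).integrable _), integral_const_mul,
    integral_const_mul] at h4
  have h5 : 2 / Real.pi * (Real.pi⁻¹ * ∫ x, f x ^ 2 ∂μ + Real.pi * ∫ x, g x ^ 2 ∂μ) =
      2 * ((∫ x, f x ^ 2 ∂μ) / Real.pi ^ 2) + 2 * ∫ x, g x ^ 2 ∂μ := by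
    field_simp
  rw [h5] at h4
  linarith

/-- For a triple x, y, z put a = U(x,y), b = U(y,z), c = U(z,x). Pointwise -(ab + bc + ca) ≤ 1/4,
and by skew-symmetry each of the three products integrates to -‖T1‖², so 3‖T1‖² ≤ 1/4. -/
theorem integral_kernelOp_one_sq_le (hU : IsSkewKernel U) (hU2 : ∀ p, |U p| ≤ 1 / 2) :
    ∫ x, kernelOp μ U (fun _ => 1) x ^ 2 ∂μ ≤ 1 / 12 := by
  set d := kernelOp μ U (fun _ => 1) with hd
  have hdb : BddMeasurable d := hU.toBddMeasurable.kernelOp μ (BddMeasurable.const 1)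
  have hdx : ∀ x, ∫ y, U (x, y) ∂μ = d x := by simp [hd, kernelOp]
  have hdy : ∀ x, ∫ y, U (y, x) ∂μ = -d x := by
    intro x
    rw [← hdx, ← integral_neg]
    exact integral_congr_ae (ae_of_all _ fun y => hU.skew y x)
  have hab : BddMeasurable fun q : (X × X) × X => U q.1 * U (q.1.2, q.2) :=
    (hU.toBddMeasurable.comp measurable_fst).mul (hU.toBddMeasurable.comp (by fun_prop))
  have hbc : BddMeasurable fun q : (X × X) × X => U (q.1.2, q.2) * U (q.2, q.1.1) :=
    (hU.toBddMeasurable.comp (by fun_prop)).mul (hU.toBddMeasurable.comp (by fun_prop))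
  have hca : BddMeasurable fun q : (X × X) × X => U (q.2, q.1.1) * U q.1 :=
    (hU.toBddMeasurable.comp (by fun_prop)).mul (hU.toBddMeasurable.comp measurable_fst)
  have hdU : BddMeasurable fun p : X × X => U p * d p.2 :=
    hU.toBddMeasurable.mul (hdb.comp measurable_snd)
  have i1 : ∫ q, U q.1 * U (q.1.2, q.2) ∂((μ.prod μ).prod μ) = -∫ x, d x ^ 2 ∂μ := by
    rw [integral_prod _ (hab.integrable _)]
    simp only [integral_const_mul, hdx]
    rw [integral_prod_symm _ (hdU.integrable _)]
    simp only [integral_mul_const, hdy]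
    rw [← integral_neg]
    exact integral_congr_ae (ae_of_all _ fun y => by ring)
  have i3 : ∫ q, U (q.2, q.1.1) * U q.1 ∂((μ.prod μ).prod μ) = -∫ x, d x ^ 2 ∂μ := by
    rw [integral_prod _ (hca.integrable _)]
    simp only [integral_mul_const, hdy]
    rw [← integral_neg, integral_prod _ ((((hdb.comp measurable_fst).neg).mul
      hU.toBddMeasurable).integrable _)]
    simp only [integral_const_mul, hdx]
    exact integral_congr_ae (ae_of_all _ fun y => by ring)
  have i2 : ∫ q, U (q.1.2, q.2) * U (q.2, q.1.1) ∂((μ.prod μ).prod μ) = -∫ x, d x ^ 2 ∂μ := by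
    rw [integral_prod_symm _ (hbc.integrable _), ← integral_neg]
    refine integral_congr_ae (ae_of_all _ fun z => ?_)
    have : ∫ p : X × X, U (p.2, z) * U (z, p.1) ∂(μ.prod μ) = d z * -d z := by
      rw [← hdy z, ← hdx z, ← integral_prod_mul]
      exact integral_congr_ae (ae_of_all _ fun p => by ring)
    simp only [this]
    ring
  have hle : ∫ q, (-(U q.1 * U (q.1.2, q.2)) - U (q.1.2, q.2) * U (q.2, q.1.1) -
      U (q.2, q.1.1) * U q.1) ∂((μ.prod μ).prod μ) ≤ ∫ _ : (X × X) × X, (1 / 4 : ℝ)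
        ∂((μ.prod μ).prod μ) := by
    refine integral_mono (((hab.neg.sub hbc).sub hca).integrable _)
      ((BddMeasurable.const _).integrable _) fun q => ?_
    have ha := abs_le.mp (hU2 q.1)
    have hb := abs_le.mp (hU2 (q.1.2, q.2))
    have hc := abs_le.mp (hU2 (q.2, q.1.1))
    generalize U q.1 = a at *
    generalize U (q.1.2, q.2) = b at *
    generalize U (q.2, q.1.1) = c at *
    dsimp only
    -- The identity (1/2-a)(1/2-b)(1/2-c) + (1/2+a)(1/2+b)(1/2+c) = 1/4 + ab + bc + ca has a
    -- nonnegative left side.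
    nlinarith [mul_nonneg (mul_nonneg (sub_nonneg.2 ha.2) (sub_nonneg.2 hb.2))
        (sub_nonneg.2 hc.2), mul_nonneg (mul_nonneg (neg_le_iff_add_nonneg.1 ha.1)
        (neg_le_iff_add_nonneg.1 hb.1)) (neg_le_iff_add_nonneg.1 hc.1)]
  rw [integral_sub ((hab.neg.sub hbc).integrable _) (hca.integrable _),
    integral_sub (hab.neg.integrable _) (hbc.integrable _), integral_neg, i1, i2, i3] at hle
  simp at hle
  linarith

/-- Skew-adjointness gives ‖Tf‖² = -⟨f, T²f⟩, so T² has no larger kernel than T. -/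
theorem kernelOp_ae_eq_zero (hU : IsSkewKernel U) (hf : BddMeasurable f)
    (h : kernelOp μ U (kernelOp μ U f) =ᵐ[μ] 0) : kernelOp μ U f =ᵐ[μ] 0 := by
  have hb := hU.toBddMeasurable.kernelOp μ hf
  have h0 : ∫ x, kernelOp μ U f x ^ 2 ∂μ = 0 := by
    have h1 := hU.integral_mul_kernelOp_left (μ := μ) hf hb
    have h2 : ∫ x, f x * kernelOp μ U (kernelOp μ U f) x ∂μ = 0 := by
      rw [integral_eq_zero_of_ae]
      filter_upwards [h] with x hx
      simp [hx]
    simp only [sq]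
    linarith
  rw [integral_eq_zero_iff_of_nonneg (fun x => sq_nonneg _) ((hb.pow 2).integrable _)] at h0
  filter_upwards [h0] with x hx
  simpa using hx

theorem kernelOp_ae_eq_zero_of_iterate (hU : IsSkewKernel U) (hf : BddMeasurable f) (n : ℕ)
    (h : (kernelOp μ U)^[n + 1] f =ᵐ[μ] 0) : kernelOp μ U f =ᵐ[μ] 0 := by
  induction n with
  | zero => exact h
  | succ n ih =>
    apply ih
    rw [Function.iterate_succ_apply', Function.iterate_succ_apply'] at h
    rw [Function.iterate_succ_apply']
    exact hU.kernelOp_ae_eq_zero (hU.toBddMeasurable.kernelOp_iterate μ hf n) h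

/-- Testing T on indicators shows that U integrates to 0 over every measurable rectangle, and
rectangles determine a finite measure. -/
theorem ae_eq_zero_of_kernelOp (hU : BddMeasurable U)
    (h : ∀ f, BddMeasurable f → kernelOp μ U f =ᵐ[μ] 0) : U =ᵐ[μ.prod μ] 0 := by
  obtain ⟨M, hM⟩ := hU.bounded
  have hrect : ∀ s t : Set X, MeasurableSet s → MeasurableSet t →
      ∫ p in s ×ˢ t, U p ∂(μ.prod μ) = 0 := by
    intro s t hs ht
    have hind : ∀ {s : Set X}, MeasurableSet s →
        BddMeasurable (s.indicator fun _ => (1 : ℝ)) := fun {s} hs =>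
      ⟨measurable_const.indicator hs, 1, fun x => by
        by_cases hx : x ∈ s <;> simp [hx]⟩
    rw [← integral_indicator (hs.prod ht)]
    have h1 := integral_mul_kernelOp μ hU (hind hs) (hind ht)
    rw [integral_eq_zero_of_ae] at h1
    · rw [h1]
      refine integral_congr_ae (ae_of_all _ fun p => ?_)
      by_cases h1 : p.1 ∈ s <;> by_cases h2 : p.2 ∈ t <;> simp [Set.indicator, h1, h2]
    · filter_upwards [h _ (hind ht)] with x hx
      simp [hx]
  have hpos : BddMeasurable fun p => U p + M := hU.add (BddMeasurable.const M)
  have hnn : ∀ p, 0 ≤ U p + M := fun p => by linarith [(abs_le.mp (hM p)).1]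
  -- Adding the bound M makes the density nonnegative, so that uniqueness of positive measures
  -- applies.
  have hmeq : (μ.prod μ).withDensity (fun p => ENNReal.ofReal (U p + M)) =
      (μ.prod μ).withDensity (fun _ => ENNReal.ofReal M) := by
    have hfin : ∀ g : X × X → ℝ, BddMeasurable g →
        IsFiniteMeasure ((μ.prod μ).withDensity fun p => ENNReal.ofReal (g p)) := fun g hg =>
      isFiniteMeasure_withDensity_ofReal (hg.integrable _).2
    have := hfin _ hpos
    have := hfin _ (BddMeasurable.const M)
    refine Measure.ext_prod fun {s t} hs ht => ?_
    rw [withDensity_apply _ (hs.prod ht), withDensity_apply _ (hs.prod ht),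
      ← ofReal_integral_eq_lintegral_ofReal (hpos.integrable _) (ae_of_all _ hnn),
      ← ofReal_integral_eq_lintegral_ofReal ((BddMeasurable.const M).integrable _)
        (ae_of_all _ fun p => (abs_nonneg _).trans (hM p)),
      integral_add (hU.integrable _) ((BddMeasurable.const M).integrable _), hrect s t hs ht,
      zero_add]
  rw [withDensity_eq_iff_of_sigmaFinite] at hmeq
  · filter_upwards [hmeq] with p hp
    have := (ENNReal.ofReal_eq_ofReal_iff (hnn p) ((abs_nonneg _).trans (hM p))).mp hp
    simpa using this
  · exact hpos.measurable.ennreal_ofReal.aemeasurable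
  · exact aemeasurable_const

/-- A skew-symmetric kernel with a vanishing power vanishes. -/
theorem ae_eq_zero_of_iterate (hU : IsSkewKernel U) (n : ℕ)
    (h : ∀ᵐ x ∂μ, (kernelOp μ U)^[n + 1] (fun y => U (y, x)) =ᵐ[μ] 0) : U =ᵐ[μ.prod μ] 0 := by
  have hUx : ∀ x, BddMeasurable fun y => U (y, x) := fun x =>
    hU.toBddMeasurable.comp (by fun_prop)
  have h1 : ∀ᵐ x ∂μ, ∀ᵐ w ∂μ, kernelOp μ U (fun y => U (y, x)) w = 0 := by
    filter_upwards [h] with x hx using hU.kernelOp_ae_eq_zero_of_iterate (hUx x) n hx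
  have hm : BddMeasurable fun p : (X × X) × X => U (p.1.2, p.2) * U (p.2, p.1.1) :=
    (hU.toBddMeasurable.comp (by fun_prop)).mul (hU.toBddMeasurable.comp (by fun_prop))
  have hmeas : Measurable fun p : X × X => kernelOp μ U (fun y => U (y, p.1)) p.2 :=
    (hm.integral_right μ).measurable
  have h2 : ∀ᵐ w ∂μ, ∀ᵐ x ∂μ, kernelOp μ U (fun y => U (y, x)) w = 0 :=
    have hs : MeasurableSet {p : X × X | kernelOp μ U (fun y => U (y, p.1)) p.2 = 0} :=
      measurableSet_eq_fun hmeas measurable_const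
    (Measure.ae_ae_comm hs).mp h1
  -- It now suffices that T²f = 0: its kernel is the composition of U with itself, which vanishes
  -- almost everywhere by `h2`.
  refine ae_eq_zero_of_kernelOp hU.toBddMeasurable fun f hf => hU.kernelOp_ae_eq_zero hf ?_
  filter_upwards [h2] with w hw
  have hb : BddMeasurable fun p : X × X => U (w, p.1) * (U (p.1, p.2) * f p.2) :=
    (hU.toBddMeasurable.comp (by fun_prop)).mul
      (hU.toBddMeasurable.mul (hf.comp measurable_snd))
  calc kernelOp μ U (kernelOp μ U f) w
      = ∫ y, ∫ x, U (w, y) * (U (y, x) * f x) ∂μ ∂μ := by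
        simp only [kernelOp, integral_const_mul]
    _ = ∫ x, ∫ y, U (w, y) * (U (y, x) * f x) ∂μ ∂μ := integral_integral_swap (hb.integrable _)
    _ = ∫ x, kernelOp μ U (fun y => U (y, x)) w * f x ∂μ := by
        simp only [kernelOp, ← integral_mul_const, mul_assoc]
    _ = 0 := by
        apply integral_eq_zero_of_ae
        filter_upwards [hw] with x hx
        simp [hx]

end IsSkewKernel

end KernelOp

/-! ### Product measures and walks -/

section PiMeasure

variable {X : Type*} [MeasureSpace X] [IsProbabilityMeasure (volume : Measure X)]

/-- Coordinates outside the image integrate to 1. Isolated vertices therefore do not affect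
densities. -/
theorem measurePreserving_comp_embedding {A B : Type*} [Fintype A] [Fintype B] (φ : A ↪ B) :
    MeasurePreserving (fun (x : B → X) (a : A) => x (φ a)) := by
  classical
  have hm : Measurable fun (x : B → X) (a : A) => x (φ a) := by fun_prop
  refine ⟨hm, (Measure.pi_eq fun s hs => ?_).symm⟩
  rw [Measure.map_apply hm (MeasurableSet.univ_pi hs)]
  have : (fun (x : B → X) (a : A) => x (φ a)) ⁻¹' Set.univ.pi s =
      Set.univ.pi fun b => ⋂ a, ⋂ (_ : φ a = b), s a := by
    ext x
    simp only [Set.mem_preimage, Set.mem_univ_pi, Set.mem_iInter]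
    exact ⟨fun h b a hab => hab ▸ h a, fun h a => h (φ a) a rfl⟩
  rw [this, volume_pi_pi]
  have hφ : ∀ a, (⋂ a', ⋂ (_ : φ a' = φ a), s a') = s a := by
    intro a
    ext x
    simp only [Set.mem_iInter]
    exact ⟨fun h => h a rfl, fun h a' ha' => by rwa [φ.injective ha']⟩
  rw [← Finset.prod_subset (Finset.subset_univ (Finset.univ.map φ)), Finset.prod_map]
  · simp only [hφ]
  · intro b _ hb
    have : (⋂ a, ⋂ (_ : φ a = b), s a) = Set.univ := by
      simp only [Set.iInter_eq_univ]
      intro a ha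
      exact absurd (Finset.mem_map_of_mem φ (Finset.mem_univ a)) (ha ▸ hb)
    rw [this, measure_univ]

theorem measurePreserving_sigma_uncurry {ι : Type*} {A : ι → Type*} [Fintype ι]
    [∀ i, Fintype (A i)] :
    MeasurePreserving (fun (x : ∀ i, A i → X) (a : Σ i, A i) => x a.1 a.2) := by
  have hm : Measurable fun (x : ∀ i, A i → X) (a : Σ i, A i) => x a.1 a.2 := by fun_prop
  refine ⟨hm, (Measure.pi_eq fun s hs => ?_).symm⟩
  rw [Measure.map_apply hm (MeasurableSet.univ_pi hs)]
  have : (fun (x : ∀ i, A i → X) (a : Σ i, A i) => x a.1 a.2) ⁻¹' Set.univ.pi s =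
      Set.univ.pi fun i => Set.univ.pi fun a => s ⟨i, a⟩ := by
    ext x
    simp [Sigma.forall]
  rw [this, volume_pi_pi, Fintype.prod_sigma]
  simp only [volume_pi_pi]

/-- Integrating out the interior vertices of a walk amounts to applying the kernel operator. -/
theorem integral_walk {U : X × X → ℝ} (hU : BddMeasurable U) {h : X → ℝ}
    (hh : BddMeasurable h) (n : ℕ) {f : X → ℝ} (hf : BddMeasurable f) :
    ∫ x : Fin (n + 1) → X, f (x 0) * (∏ i : Fin n, U (x i.castSucc, x i.succ)) *
      h (x (Fin.last n)) = ∫ x, f x * (kernelOp volume U)^[n] h x := by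
  induction n generalizing f with
  | zero =>
    have hmp : MeasurePreserving (Function.eval (0 : Fin 1)) (volume : Measure (Fin 1 → X)) volume :=
      measurePreserving_eval _ 0
    simp only [Function.iterate_zero_apply]
    rw [← hmp.map_eq, integral_map hmp.measurable.aemeasurable
      (hf.mul hh).measurable.aestronglyMeasurable]
    simp
  | succ n ih =>
    have hmp := (volume_preserving_piFinSuccAbove (fun _ : Fin (n + 2) => X) 0).symm
    rw [← hmp.integral_comp', Measure.volume_eq_prod, integral_prod]
    · simp only [MeasurableEquiv.piFinSuccAbove_symm_apply, Fin.insertNthEquiv_zero,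
        Fin.consEquiv_apply, Fin.prod_univ_succ]
      refine integral_congr_ae (ae_of_all _ fun x => ?_)
      have hUx : BddMeasurable fun y => U (x, y) := hU.comp (by fun_prop)
      have := ih hUx
      -- With the first vertex fixed at x, the rest is a shorter walk whose initial weight is U(x,
      -- ·).
      rw [Function.iterate_succ_apply']
      simp only [kernelOp]
      simp only [← this, ← integral_const_mul]
      refine integral_congr_ae (ae_of_all _ fun y => ?_)
      simp only [← Fin.succ_castSucc, ← Fin.succ_last, Fin.cons_succ, Fin.castSucc_zero,
        Fin.cons_zero]
      ring
    · apply BddMeasurable.integrable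
      have hb : BddMeasurable fun x : Fin (n + 1 + 1) → X => f (x 0) *
          (∏ i : Fin (n + 1), U (x i.castSucc, x i.succ)) * h (x (Fin.last (n + 1))) :=
        ((hf.comp (by fun_prop)).mul (BddMeasurable.prod _ fun i _ =>
          hU.comp (by fun_prop))).mul (hh.comp (by fun_prop))
      exact hb.comp (MeasurableEquiv.measurable _)

end PiMeasure

/-! ### Densities under reversal and disjoint union -/

namespace OrientedGraph

variable {U : unitInterval × unitInterval → ℝ}

theorem mem_edges {V : Type*} [Fintype V] {G : OrientedGraph V} {e : V × V} :
    e ∈ G.edges ↔ G.Adj e.1 e.2 := by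
  classical simp [edges]

theorem bddMeasurable_prod_edges {V : Type*} (hU : BddMeasurable U) (s : Finset (V × V)) :
    BddMeasurable fun x : V → unitInterval => ∏ e ∈ s, U (x e.1, x e.2) :=
  BddMeasurable.prod s fun e _ => hU.comp (by fun_prop)

theorem edges_spanning {V : Type*} [Fintype V] {G : OrientedGraph V} {F : Finset (V × V)}
    (hF : F ⊆ G.edges) : (G.spanning F).edges = F := by
  ext e
  rw [mem_edges]
  exact ⟨fun h => h.2, fun h => ⟨mem_edges.mp (hF h), h⟩⟩

theorem edges_of_embedding {A B : Type*} [Fintype A] [Fintype B] {G : OrientedGraph A}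
    {H : OrientedGraph B} {φ : A ↪ B}
    (h : ∀ u v, H.Adj u v ↔ ∃ a b, φ a = u ∧ φ b = v ∧ G.Adj a b) :
    H.edges = G.edges.map (φ.prodMap φ) := by
  ext ⟨u, v⟩
  rw [mem_edges, h]
  simp only [Finset.mem_map, mem_edges, Prod.exists, Function.Embedding.coe_prodMap,
    Prod.map_apply, Prod.mk.injEq]
  exact ⟨fun ⟨a, b, h1, h2, h3⟩ => ⟨a, b, h3, h1, h2⟩, fun ⟨a, b, h3, h1, h2⟩ => ⟨a, b, h1, h2, h3⟩⟩

theorem IsIsoAddIsolated.card_edges {A B : Type*} [Fintype A] [Fintype B] {G : OrientedGraph A}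
    {H : OrientedGraph B} (h : IsIsoAddIsolated G H) : H.edges.card = G.edges.card := by
  obtain ⟨φ, hφ⟩ := h
  rw [edges_of_embedding hφ, Finset.card_map]

theorem IsIsoAddIsolated.density_eq {A B : Type*} [Fintype A] [Fintype B] {G : OrientedGraph A}
    {H : OrientedGraph B} (h : IsIsoAddIsolated G H) (hU : BddMeasurable U) :
    H.density U = G.density U := by
  obtain ⟨φ, hφ⟩ := h
  have hmp := measurePreserving_comp_embedding (X := unitInterval) φ
  rw [density, density, ← hmp.map_eq, integral_map hmp.measurable.aemeasurable
    (bddMeasurable_prod_edges hU _).measurable.aestronglyMeasurable, edges_of_embedding hφ]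
  simp

open Classical in
theorem edges_reverse {V : Type*} [Fintype V] {G : OrientedGraph V} {R : Finset (V × V)}
    (hR : R ⊆ G.edges) :
    (G.reverse R).edges = (G.edges \ R).disjUnion (R.map (Equiv.prodComm V V).toEmbedding)
      (by
        rw [Finset.disjoint_left]
        rintro e h1 h2
        obtain ⟨e', he', rfl⟩ := Finset.mem_map.mp h2
        exact G.asymm _ _ (mem_edges.mp (Finset.mem_sdiff.mp h1).1) (mem_edges.mp (hR he'))) := by
  ext ⟨u, v⟩
  simp only [mem_edges, reverse, Finset.mem_disjUnion, Finset.mem_sdiff, Finset.mem_map,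
    Equiv.coe_toEmbedding, Equiv.prodComm_apply, Prod.exists, Prod.swap_prod_mk, Prod.mk.injEq]
  constructor
  · rintro (h | h)
    · exact Or.inl h
    · exact Or.inr ⟨v, u, h.2, rfl, rfl⟩
  · rintro (h | ⟨a, b, h, rfl, rfl⟩)
    · exact Or.inl h
    · exact Or.inr ⟨mem_edges.mp (hR h), h⟩

theorem card_edges_reverse {V : Type*} [Fintype V] {G : OrientedGraph V} {R : Finset (V × V)}
    (hR : R ⊆ G.edges) : (G.reverse R).edges.card = G.edges.card := by
  classical
  rw [edges_reverse hR, Finset.card_disjUnion, Finset.card_map, Finset.card_sdiff_add_card_eq_card hR]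

theorem density_reverse {V : Type*} [Fintype V] {G : OrientedGraph V} {R : Finset (V × V)}
    (hR : R ⊆ G.edges) (hU : IsSkewKernel U) :
    (G.reverse R).density U = (-1) ^ R.card * G.density U := by
  classical
  rw [density, density, ← integral_const_mul]
  refine integral_congr_ae (ae_of_all _ fun x => ?_)
  simp only [edges_reverse hR, Finset.prod_disjUnion, Finset.prod_map]
  have : ∏ e ∈ R, U (x ((Equiv.prodComm V V).toEmbedding e).1,
      x ((Equiv.prodComm V V).toEmbedding e).2) = (-1) ^ R.card * ∏ e ∈ R, U (x e.1, x e.2) := by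
    rw [← Finset.prod_const, ← Finset.prod_mul_distrib]
    refine Finset.prod_congr rfl fun e _ => ?_
    simp only [Equiv.coe_toEmbedding, Equiv.prodComm_apply, Prod.fst_swap, Prod.snd_swap]
    rw [hU.skew]
    ring
  rw [this, mul_left_comm, Finset.prod_sdiff hR]

open Classical in
theorem edges_disjUnion {ι : Type*} [Fintype ι] {V : ι → Type*} [∀ i, Fintype (V i)]
    (G : ∀ i, OrientedGraph (V i)) :
    (disjUnion G).edges = (Finset.univ.sigma fun i => (G i).edges).image
      fun e => (⟨e.1, e.2.1⟩, ⟨e.1, e.2.2⟩) := by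
  ext ⟨a, b⟩
  rw [mem_edges]
  simp only [disjUnion, Finset.mem_image, Finset.mem_sigma, Finset.mem_univ, true_and,
    Sigma.exists, mem_edges, Prod.exists, Prod.mk.injEq]
  constructor
  · rintro ⟨i, u, v, rfl, rfl, h⟩
    exact ⟨i, u, v, h, rfl, rfl⟩
  · rintro ⟨i, u, v, h, rfl, rfl⟩
    exact ⟨i, u, v, rfl, rfl, h⟩

theorem prod_edges_disjUnion {M : Type*} [CommMonoid M] {ι : Type*} [Fintype ι] {V : ι → Type*}
    [∀ i, Fintype (V i)] (G : ∀ i, OrientedGraph (V i)) (f : (Σ i, V i) × (Σ i, V i) → M) :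
    ∏ e ∈ (disjUnion G).edges, f e =
      ∏ i, ∏ e ∈ (G i).edges, f (⟨i, e.1⟩, ⟨i, e.2⟩) := by
  classical
  rw [edges_disjUnion, Finset.prod_image, Finset.prod_sigma]
  rintro ⟨i, a, b⟩ _ ⟨j, c, d⟩ _ h
  simp only [Prod.mk.injEq, Sigma.mk.injEq] at h
  obtain ⟨⟨rfl, h1⟩, _, h2⟩ := h
  obtain rfl := eq_of_heq h1
  obtain rfl := eq_of_heq h2
  rfl

theorem card_edges_disjUnion {ι : Type*} [Fintype ι] {V : ι → Type*} [∀ i, Fintype (V i)]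
    (G : ∀ i, OrientedGraph (V i)) : (disjUnion G).edges.card = ∑ i, (G i).edges.card := by
  classical
  rw [edges_disjUnion, Finset.card_image_of_injOn, Finset.card_sigma]
  rintro ⟨i, a, b⟩ _ ⟨j, c, d⟩ _ h
  simp only [Prod.mk.injEq, Sigma.mk.injEq] at h
  obtain ⟨⟨rfl, h1⟩, _, h2⟩ := h
  obtain rfl := eq_of_heq h1
  obtain rfl := eq_of_heq h2
  rfl

theorem density_disjUnion {ι : Type*} [Fintype ι] {V : ι → Type*} [∀ i, Fintype (V i)]
    (G : ∀ i, OrientedGraph (V i)) (hU : BddMeasurable U) :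
    (disjUnion G).density U = ∏ i, (G i).density U := by
  have hmp := measurePreserving_sigma_uncurry (X := unitInterval) (A := V)
  rw [density, ← hmp.map_eq, integral_map hmp.measurable.aemeasurable
    (bddMeasurable_prod_edges hU _).measurable.aestronglyMeasurable]
  simp only [prod_edges_disjUnion, density]
  exact integral_fintype_prod_volume_eq_prod
    (fun i (x : V i → unitInterval) => ∏ e ∈ (G i).edges, U (x e.1, x e.2))

end OrientedGraph

/-! ### Closed walks -/

section ClosedWalk

variable {X : Type*} [MeasureSpace X] [IsProbabilityMeasure (volume : Measure X)]

/-- Fixing vertex 0 at x leaves an open walk with initial weight U(x, ·) and final weight U(·, x).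
-/
theorem integral_closed_walk {U : X × X → ℝ} (hU : BddMeasurable U) (k : ℕ) :
    ∫ x : Fin (k + 2) → X, (∏ i : Fin (k + 1), U (x i.castSucc, x i.succ)) *
      U (x (Fin.last (k + 1)), x 0) =
      ∫ x, ∫ y, U (x, y) * (kernelOp volume U)^[k] (fun z => U (z, x)) y := by
  have hmp := (volume_preserving_piFinSuccAbove (fun _ : Fin (k + 2) => X) 0).symm
  rw [← hmp.integral_comp', Measure.volume_eq_prod, integral_prod]
  · simp only [MeasurableEquiv.piFinSuccAbove_symm_apply, Fin.insertNthEquiv_zero,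
      Fin.consEquiv_apply, Fin.prod_univ_succ]
    refine integral_congr_ae (ae_of_all _ fun x => ?_)
    have hUx : BddMeasurable fun y => U (x, y) := hU.comp (by fun_prop)
    have hUx' : BddMeasurable fun y => U (y, x) := hU.comp (by fun_prop)
    dsimp only
    rw [← integral_walk hU hUx' k hUx]
    refine integral_congr_ae (ae_of_all _ fun y => ?_)
    simp only [← Fin.succ_castSucc, ← Fin.succ_last, Fin.cons_succ, Fin.castSucc_zero,
      Fin.cons_zero]
  · apply BddMeasurable.integrable
    have hb : BddMeasurable fun x : Fin (k + 1 + 1) → X =>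
        (∏ i : Fin (k + 1), U (x i.castSucc, x i.succ)) * U (x (Fin.last (k + 1)), x 0) :=
      (BddMeasurable.prod _ fun i _ => hU.comp (by fun_prop)).mul (hU.comp (by fun_prop))
    exact hb.comp (MeasurableEquiv.measurable _)

end ClosedWalk

/-! ### Densities of paths and cycles as squared norms -/

namespace OrientedGraph

variable {U : unitInterval × unitInterval → ℝ}

/-- The directed path `0 → 1 → ⋯ → n`. -/
def dirPath (n : ℕ) : OrientedGraph (Fin (n + 1)) where
  Adj a b := b.val = a.val + 1
  asymm a b h h' := by omega

/-- The directed cycle `0 → 1 → ⋯ → ℓ - 1 → 0`. -/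
def dirCycle (ℓ : ℕ) (h3 : 3 ≤ ℓ) : OrientedGraph (Fin ℓ) where
  Adj a b := b.val = a.val + 1 ∨ (a.val + 1 = ℓ ∧ b.val = 0)
  asymm a b h h' := by omega

/-- The enumeration of the edges of the directed path. -/
def pathStep (n : ℕ) : Fin n ↪ Fin (n + 1) × Fin (n + 1) where
  toFun i := (i.castSucc, i.succ)
  inj' i j h := by simpa using congrArg Prod.fst h

@[simp]
theorem pathStep_apply (n : ℕ) (i : Fin n) : pathStep n i = (i.castSucc, i.succ) := rfl

/-- The enumeration of the edges of the directed cycle. -/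
def cycleStep (ℓ : ℕ) (h3 : 3 ≤ ℓ) : Fin ℓ ↪ Fin ℓ × Fin ℓ where
  toFun i := (i, if h : i.val + 1 < ℓ then ⟨i.val + 1, h⟩ else ⟨0, by omega⟩)
  inj' i j h := by simpa using congrArg Prod.fst h

theorem cycleStep_apply {ℓ : ℕ} (h3 : 3 ≤ ℓ) (i : Fin ℓ) : cycleStep ℓ h3 i =
    (i, if h : i.val + 1 < ℓ then ⟨i.val + 1, h⟩ else ⟨0, by omega⟩) := rfl

theorem edges_dirPath (n : ℕ) : (dirPath n).edges = Finset.univ.map (pathStep n) := by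
  ext ⟨a, b⟩
  simp only [mem_edges, dirPath, Finset.mem_map, Finset.mem_univ, true_and,
    pathStep_apply, Prod.mk.injEq]
  constructor
  · intro h
    exact ⟨⟨a.val, by omega⟩, Fin.ext rfl, Fin.ext h.symm⟩
  · rintro ⟨i, rfl, rfl⟩
    rfl

theorem card_edges_dirPath (n : ℕ) : (dirPath n).edges.card = n := by
  simp [edges_dirPath]

theorem density_dirPath (hU : BddMeasurable U) (n : ℕ) :
    (dirPath n).density U = ∫ x, (kernelOp volume U)^[n] (fun _ => 1) x := by
  have := integral_walk hU (BddMeasurable.const 1) n (BddMeasurable.const 1)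
  simp only [one_mul, mul_one] at this
  rw [← this, density, edges_dirPath]
  simp

/-- The density of `Q_{2m}` in a skew-symmetric kernel is a squared norm. -/
noncomputable def pathNorm (U : unitInterval × unitInterval → ℝ) (m : ℕ) : ℝ :=
  ∫ x, (kernelOp volume U)^[m] (fun _ => 1) x ^ 2

theorem density_dirPath_even (hU : IsSkewKernel U) (m : ℕ) :
    (dirPath (2 * m)).density U = (-1) ^ m * pathNorm U m := by
  rw [density_dirPath hU.toBddMeasurable, pathNorm,
    ← hU.integral_mul_kernelOp_iterate_even (BddMeasurable.const 1)]
  simp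

theorem density_dirPath_odd (hU : IsSkewKernel U) {n : ℕ} (hn : Odd n) :
    (dirPath n).density U = 0 := by
  rw [density_dirPath hU.toBddMeasurable,
    ← hU.integral_mul_kernelOp_iterate_odd (μ := volume) (BddMeasurable.const 1) hn]
  simp

theorem ext_adj {V : Type*} {G H : OrientedGraph V} (h : ∀ u v, G.Adj u v ↔ H.Adj u v) :
    G = H := by
  cases G
  cases H
  congr
  funext u v
  exact propext (h u v)

theorem card_filter_val_lt_two_mul (m : ℕ) :
    (Finset.univ.filter fun i : Fin (2 * m) => i.val < m).card = m := by
  rw [Fin.card_filter_val_lt]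
  omega

/-- Exactly the first m edges are reversed, and this sign (-1)^m cancels the one in the density of
the directed path. -/
theorem pathQ_eq_reverse (m : ℕ) : ∃ R ⊆ (dirPath (2 * m)).edges, R.card = m ∧
    pathQ m = (dirPath (2 * m)).reverse R := by
  refine ⟨(dirPath (2 * m)).edges.filter fun e => e.1.val < m, Finset.filter_subset _ _, ?_, ?_⟩
  · have : (dirPath (2 * m)).edges.filter (fun e => e.1.val < m) =
        (Finset.univ.filter fun i : Fin (2 * m) => i.val < m).map (pathStep (2 * m)) := by
      ext e
      simp only [edges_dirPath, Finset.mem_filter, Finset.mem_map, Finset.mem_univ, true_and]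
      constructor
      · rintro ⟨⟨i, rfl⟩, h⟩
        exact ⟨i, h, rfl⟩
      · rintro ⟨i, h, rfl⟩
        exact ⟨⟨i, rfl⟩, h⟩
    rw [this, Finset.card_map, card_filter_val_lt_two_mul]
  · refine ext_adj fun a b => ?_
    simp only [pathQ, reverse, dirPath, Finset.mem_filter, mem_edges]
    omega

theorem density_pathQ (hU : IsSkewKernel U) (m : ℕ) : (pathQ m).density U = pathNorm U m := by
  obtain ⟨R, hR, hcard, h⟩ := pathQ_eq_reverse m
  rw [h, density_reverse hR hU, hcard, density_dirPath_even hU, ← mul_assoc, ← mul_pow]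
  simp

theorem card_edges_pathQ (m : ℕ) : (pathQ m).edges.card = 2 * m := by
  obtain ⟨R, hR, hcard, h⟩ := pathQ_eq_reverse m
  rw [h, card_edges_reverse hR, card_edges_dirPath]

theorem edges_dirCycle {ℓ : ℕ} (h3 : 3 ≤ ℓ) : (dirCycle ℓ h3).edges =
    Finset.univ.map (cycleStep ℓ h3) := by
  ext ⟨a, b⟩
  simp only [mem_edges, dirCycle, Finset.mem_map, Finset.mem_univ, true_and,
    cycleStep_apply, Prod.mk.injEq]
  constructor
  · rintro h
    refine ⟨a, rfl, ?_⟩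
    split_ifs with h1 <;> apply Fin.ext <;> dsimp only <;> omega
  · rintro ⟨i, rfl, rfl⟩
    split_ifs with h1 <;> dsimp only <;> omega

theorem card_edges_dirCycle {ℓ : ℕ} (h3 : 3 ≤ ℓ) : (dirCycle ℓ h3).edges.card = ℓ := by
  simp [edges_dirCycle]

theorem density_dirCycle (hU : BddMeasurable U) {ℓ k : ℕ} (h3 : 3 ≤ ℓ) (hk : ℓ = k + 2) :
    (dirCycle ℓ h3).density U =
      ∫ x, ∫ y, U (x, y) * (kernelOp volume U)^[k] (fun z => U (z, x)) y := by
  subst hk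
  rw [← integral_closed_walk hU, density, edges_dirCycle]
  refine integral_congr_ae (ae_of_all _ fun x => ?_)
  simp only [Finset.prod_map, cycleStep_apply, Fin.prod_univ_castSucc (n := k + 1)]
  congr 1
  · refine Finset.prod_congr rfl fun i _ => ?_
    congr 2
    have : (i.castSucc : Fin (k + 1 + 1)).val + 1 < k + 2 := by
      rw [Fin.val_castSucc]
      omega
    rw [dif_pos this]
    rfl
  · simp

/-- The density of `D_{2m}` in a skew-symmetric kernel is a squared norm. -/
theorem density_dirCycle_even (hU : IsSkewKernel U) {m : ℕ} (h3 : 3 ≤ 2 * (m + 1)) :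
    (dirCycle (2 * (m + 1)) h3).density U =
      (-1) ^ (m + 1) * ∫ x, ∫ y, (kernelOp volume U)^[m] (fun z => U (z, x)) y ^ 2 := by
  rw [density_dirCycle hU.toBddMeasurable (k := 2 * m) h3 rfl, ← integral_const_mul]
  refine integral_congr_ae (ae_of_all _ fun x => ?_)
  have := hU.integral_mul_kernelOp_iterate_even (μ := volume) (f := fun z => U (z, x))
    (hU.toBddMeasurable.comp (by fun_prop)) m
  dsimp only
  rw [pow_succ, mul_neg_one, neg_mul, ← this, ← integral_neg]
  refine integral_congr_ae (ae_of_all _ fun y => ?_)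
  dsimp only
  -- Turning U(x,y) into -U(y,x) supplies the last sign and makes the two end weights equal.
  rw [hU.skew x y]
  ring

theorem cycleD_eq_reverse {m : ℕ} (h3 : 3 ≤ 2 * m) : ∃ R ⊆ (dirCycle (2 * m) h3).edges,
    R.card = m ∧ cycleD m = (dirCycle (2 * m) h3).reverse R := by
  -- The m edges leaving m, …, 2m-1 are reversed, including the closing edge from 2m-1 to 0.
  refine ⟨(dirCycle (2 * m) h3).edges.filter fun e => ¬ e.1.val < m, Finset.filter_subset _ _,
    ?_, ?_⟩
  · rw [edges_dirCycle, Finset.filter_map, Finset.card_map]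
    simp only [Function.comp_def, cycleStep_apply]
    have := Finset.card_filter_add_card_filter_not (s := (Finset.univ : Finset (Fin (2 * m))))
      (fun i => i.val < m)
    rw [card_filter_val_lt_two_mul, Finset.card_univ, Fintype.card_fin] at this
    have h2 : (Finset.univ.filter fun i : Fin (2 * m) => ¬ i.val < m).card = m := by omega
    convert h2 using 2
    ext i
    constructor <;> intro h <;> simpa [Finset.mem_filter] using h
  · refine ext_adj fun a b => ?_
    simp only [cycleD, reverse, dirCycle, Finset.mem_filter, mem_edges]
    omega

theorem density_cycleD (hU : IsSkewKernel U) {m : ℕ} (hm : 1 ≤ m) :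
    (cycleD (m + 1)).density U =
      ∫ x, ∫ y, (kernelOp volume U)^[m] (fun z => U (z, x)) y ^ 2 := by
  obtain ⟨R, hR, hcard, h⟩ := cycleD_eq_reverse (m := m + 1) (by omega)
  rw [h, density_reverse hR hU, hcard, density_dirCycle_even hU, ← mul_assoc, ← mul_pow]
  simp

theorem density_cycleD_nonneg (hU : IsSkewKernel U) {m : ℕ} (hm : 2 ≤ m) :
    0 ≤ (cycleD m).density U := by
  obtain ⟨m, rfl⟩ := Nat.exists_eq_add_of_le' (show 1 ≤ m by omega)
  rw [density_cycleD hU (by omega)]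
  exact integral_nonneg fun x => integral_nonneg fun y => sq_nonneg _

/-- The density is an integral of squares of a power of U; when it vanishes so does that power, and
then U itself by skew-symmetry. -/
theorem ae_eq_zero_of_density_cycleD (hU : IsSkewKernel U) {m : ℕ} (hm : 2 ≤ m)
    (h : (cycleD m).density U = 0) : U =ᵐ[volume] 0 := by
  obtain ⟨m, rfl⟩ := Nat.exists_eq_add_of_le' hm
  rw [density_cycleD hU (by omega)] at h
  have hb : ∀ n, BddMeasurable fun p : unitInterval × unitInterval =>
      (kernelOp volume U)^[n] (fun z => U (z, p.1)) p.2 := by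
    intro n
    induction n with
    | zero => exact hU.toBddMeasurable.comp (by fun_prop)
    | succ n ih =>
      simp only [Function.iterate_succ_apply']
      have h2 : BddMeasurable fun q : (unitInterval × unitInterval) × unitInterval =>
          U (q.1.2, q.2) * (kernelOp volume U)^[n] (fun z => U (z, q.1.1)) q.2 :=
        (hU.toBddMeasurable.comp (by fun_prop)).mul
          (ih.comp (φ := fun q : (unitInterval × unitInterval) × unitInterval =>
            (q.1.1, q.2)) (by fun_prop))
      exact h2.integral_right volume
  refine hU.ae_eq_zero_of_iterate m ?_
  rw [integral_eq_zero_iff_of_nonneg (fun x => integral_nonneg fun y => sq_nonneg _)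
    ((((hb (m + 1)).pow 2).integral_right volume).integrable _)] at h
  filter_upwards [h] with x hx
  have hUx : BddMeasurable fun z => U (z, x) := hU.toBddMeasurable.comp (by fun_prop)
  rw [Pi.zero_apply, integral_eq_zero_iff_of_nonneg (fun y => sq_nonneg _)
    (((hU.toBddMeasurable.kernelOp_iterate volume hUx (m + 1)).pow 2).integrable _)] at hx
  filter_upwards [hx] with y hy
  simpa using hy

/-! ### Bounds on path norms -/

theorem pathNorm_nonneg (m : ℕ) : 0 ≤ pathNorm U m := integral_nonneg fun _ => sq_nonneg _

theorem pathNorm_one_le (hU : IsSkewKernel U) (hU2 : ∀ p, |U p| ≤ 1 / 2) :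
    pathNorm U 1 ≤ 1 / 12 := hU.integral_kernelOp_one_sq_le hU2

theorem pathNorm_add_le (hU : IsSkewKernel U) (hU2 : ∀ p, |U p| ≤ 1 / 2) (m j : ℕ) :
    pathNorm U (m + j) ≤ pathNorm U m / Real.pi ^ (2 * j) := by
  induction j with
  | zero => simp
  | succ j ih =>
    have := hU.integral_kernelOp_sq_le (μ := volume) hU2
      (hU.toBddMeasurable.kernelOp_iterate volume (BddMeasurable.const 1) (m + j))
    rw [← add_assoc, pathNorm]
    simp only [Function.iterate_succ_apply']
    refine this.trans ?_
    rw [mul_add, pow_add, ← div_div, mul_one]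
    exact div_le_div_of_nonneg_right ih (by positivity)

/-! ### Underlying graphs and their decomposition into paths -/

theorem underlying_reverse {V : Type*} [Fintype V] {G : OrientedGraph V} {R : Finset (V × V)}
    (hR : R ⊆ G.edges) : (G.reverse R).underlying = G.underlying := by
  ext u v
  have h1 : (u, v) ∈ R → G.Adj u v := fun h => mem_edges.mp (hR h)
  have h2 : (v, u) ∈ R → G.Adj v u := fun h => mem_edges.mp (hR h)
  simp only [underlying, reverse]
  tauto

theorem underlying_eq_map_of_embedding {A B : Type*} {G : OrientedGraph A} {H : OrientedGraph B}
    {φ : A ↪ B} (h : ∀ u v, H.Adj u v ↔ ∃ a b, φ a = u ∧ φ b = v ∧ G.Adj a b) :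
    H.underlying = G.underlying.map φ := by
  ext u v
  simp only [underlying, h, SimpleGraph.map_adj]
  constructor
  · rintro (⟨a, b, ha, hb, hab⟩ | ⟨a, b, ha, hb, hab⟩)
    · exact ⟨a, b, Or.inl hab, ha, hb⟩
    · exact ⟨b, a, Or.inr hab, hb, ha⟩
  · rintro ⟨a, b, hab | hab, ha, hb⟩
    · exact Or.inl ⟨a, b, ha, hb, hab⟩
    · exact Or.inr ⟨b, a, hb, ha, hab⟩

/-- Two oriented graphs with the same underlying graph differ by the reversal of some edges. -/
theorem exists_reverse_of_underlying_eq_map {A B : Type*} [Fintype A] {G : OrientedGraph A}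
    {H : OrientedGraph B} {φ : A ↪ B} (h : H.underlying = G.underlying.map φ) :
    ∃ R ⊆ G.edges, ∀ u v, H.Adj u v ↔ ∃ a b, φ a = u ∧ φ b = v ∧ (G.reverse R).Adj a b := by
  classical
  have h' : ∀ u v, (H.Adj u v ∨ H.Adj v u) ↔
      ∃ a b, (G.Adj a b ∨ G.Adj b a) ∧ φ a = u ∧ φ b = v := by
    intro u v
    have := congrArg (fun K => SimpleGraph.Adj K u v) h
    simp only [SimpleGraph.map_adj, eq_iff_iff] at this
    exact this
  -- The edges to reverse are those whose images point the other way in H.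
  refine ⟨G.edges.filter fun e => H.Adj (φ e.2) (φ e.1), Finset.filter_subset _ _, fun u v => ?_⟩
  simp only [reverse, Finset.mem_filter, mem_edges]
  constructor
  · intro huv
    obtain ⟨a, b, hab, rfl, rfl⟩ := (h' u v).mp (Or.inl huv)
    have := H.asymm _ _ huv
    refine ⟨a, b, rfl, rfl, ?_⟩
    tauto
  · rintro ⟨a, b, rfl, rfl, hab⟩
    have := (h' (φ a) (φ b)).mpr ⟨a, b, by tauto, rfl, rfl⟩
    tauto

end OrientedGraph

/-- A graph all of whose edges join consecutive numbers is a disjoint union of paths. -/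
theorem SimpleGraph.exists_runs {V : Type*} {N : ℕ} (H : SimpleGraph V) (ρ : V ≃ Fin N)
    (hH : ∀ u v, H.Adj u v → (ρ v).val = (ρ u).val + 1 ∨ (ρ u).val = (ρ v).val + 1) :
    ∃ (k : ℕ) (n : Fin k → ℕ) (φ : (Σ i, Fin (n i + 1)) ↪ V), Monotone n ∧ (∀ i, 1 ≤ n i) ∧
      H = (OrientedGraph.disjUnion fun i => OrientedGraph.dirPath (n i)).underlying.map φ := by
  classical
  -- S i says that the edge from position i to i+1 is present; `len i` counts the consecutive edges
  -- present from i on, and `start i` marks the first edge of a maximal run.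
  set S : ℕ → Prop := fun i => ∃ u v, (ρ u).val = i ∧ (ρ v).val = i + 1 ∧ H.Adj u v with hS
  have hSN : ∀ i, S i → i + 1 < N := by
    rintro i ⟨u, v, hu, hv, -⟩
    have := (ρ v).isLt
    omega
  have hex : ∀ i, ∃ m, ¬S (i + m) := fun i => ⟨N, fun h => by have := hSN _ h; omega⟩
  set len : ℕ → ℕ := fun i => Nat.find (hex i) with hlen
  have hlen1 : ∀ i m, m < len i → S (i + m) := fun i m hm => by
    by_contra h
    exact Nat.find_min (hex i) hm h
  have hlen2 : ∀ i m, (∀ t, t < m → S (i + t)) → m ≤ len i := fun i m hm => by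
    by_contra h
    exact Nat.find_spec (hex i) (hm _ (not_le.mp h))
  set start : ℕ → Prop := fun i => S i ∧ ∀ j, i = j + 1 → ¬S j with hstart
  have hfind : ∀ u, S u → ∃ i m, u = i + m ∧ start i ∧ m < len i := by
    intro u
    induction u with
    | zero =>
      intro h
      refine ⟨0, 0, rfl, ⟨h, by omega⟩, ?_⟩
      exact hlen2 0 1 fun t ht => by rwa [show 0 + t = 0 by omega]
    | succ u ih =>
      intro h
      by_cases hu : S u
      · obtain ⟨i, m, rfl, hi, hm⟩ := ih hu
        refine ⟨i, m + 1, rfl, hi, hlen2 i (m + 2) fun t ht => ?_⟩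
        rcases Nat.lt_or_ge t (m + 1) with h1 | h1
        · exact hlen1 i t (by omega)
        · obtain rfl : t = m + 1 := by omega
          exact h
      · refine ⟨u + 1, 0, rfl, ⟨h, fun j hj => by rwa [← Nat.succ_injective hj]⟩, ?_⟩
        exact hlen2 (u + 1) 1 fun t ht => by rwa [show u + 1 + t = u + 1 by omega]
  -- Two runs sharing a vertex coincide: if j came after i, the edge ending at j would lie in the
  -- run of i, so j could not be a start.
  have hdisj : ∀ i j a b, start i → start j → i + a = j + b → a ≤ len i → i ≤ j → i = j := by
    intro i j a b _ hj hab ha hle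
    by_contra hne
    obtain ⟨m, rfl⟩ := Nat.exists_eq_add_of_lt (lt_of_le_of_ne hle hne)
    exact hj.2 (i + m) rfl (hlen1 i m (by omega))
  have hlt : ∀ i j, i < N → j ≤ len i → i + j < N := by
    intro i j hi hj
    rcases j with _ | j
    · exact hi
    · have := hSN _ (hlen1 i j (by omega))
      omega
  let e := (Fintype.equivFin {i : Fin N // start i.val}).symm
  -- Sorting the runs by length makes the tuple monotone, as the normal form requires.
  let σ := Tuple.sort fun a => len (e a).1.val
  let n : Fin (Fintype.card {i : Fin N // start i.val}) → ℕ := fun a => len (e (σ a)).1.val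
  have hinj : Function.Injective fun x : Σ i, Fin (n i + 1) =>
      ρ.symm ⟨(e (σ x.1)).1.val + x.2.val, hlt _ _ (e (σ x.1)).1.isLt
        (Nat.lt_succ_iff.mp x.2.isLt)⟩ := by
    rintro ⟨a, i⟩ ⟨b, j⟩ h
    have h1 : (e (σ a)).1.val + i.val = (e (σ b)).1.val + j.val := by
      have := ρ.symm.injective h
      exact congrArg Fin.val this
    have h2 : (e (σ a)).1.val = (e (σ b)).1.val := by
      rcases le_total (e (σ a)).1.val (e (σ b)).1.val with h3 | h3
      · exact hdisj _ _ _ _ (e (σ a)).2 (e (σ b)).2 h1 (Nat.lt_succ_iff.mp i.isLt) h3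
      · exact (hdisj _ _ _ _ (e (σ b)).2 (e (σ a)).2 h1.symm (Nat.lt_succ_iff.mp j.isLt) h3).symm
    obtain rfl : a = b := σ.injective (e.injective (Subtype.ext (Fin.ext h2)))
    have h3 : i = j := Fin.ext (by omega)
    rw [h3]
  refine ⟨_, n, ⟨_, hinj⟩, Tuple.monotone_sort fun a => len (e a).1.val, fun a => ?_, ?_⟩
  · exact hlen2 _ 1 fun t ht => by
      rw [show (e (σ a)).1.val + t = (e (σ a)).1.val by omega]
      exact (e (σ a)).2.1
  · have key : ∀ u v, (ρ v).val = (ρ u).val + 1 → H.Adj u v → ∃ a b,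
        (OrientedGraph.disjUnion fun i => OrientedGraph.dirPath (n i)).Adj a b ∧
        (⟨_, hinj⟩ : (Σ i, Fin (n i + 1)) ↪ V) a = u ∧
        (⟨_, hinj⟩ : (Σ i, Fin (n i + 1)) ↪ V) b = v := by
      intro u v h huv
      obtain ⟨i, m, hu, hi, hm⟩ := hfind (ρ u).val ⟨u, v, rfl, h, huv⟩
      have hiN : i < N := by have := hSN i hi.1; omega
      obtain ⟨a, ha⟩ := σ.surjective (e.symm ⟨⟨i, hiN⟩, hi⟩)
      have ha' : (e (σ a)).1.val = i := by rw [ha, e.apply_symm_apply]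
      have hna : n a = len i := congrArg len ha'
      refine ⟨⟨a, ⟨m, by omega⟩⟩, ⟨a, ⟨m + 1, by omega⟩⟩,
        ⟨a, _, _, rfl, rfl, rfl⟩, ?_, ?_⟩
      · rw [Function.Embedding.coeFn_mk, Equiv.symm_apply_eq]
        apply Fin.ext
        dsimp only
        omega
      · rw [Function.Embedding.coeFn_mk, Equiv.symm_apply_eq]
        apply Fin.ext
        dsimp only
        omega
    have key2 : ∀ a b, (OrientedGraph.disjUnion fun i => OrientedGraph.dirPath (n i)).Adj a b →
        H.Adj ((⟨_, hinj⟩ : (Σ i, Fin (n i + 1)) ↪ V) a)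
          ((⟨_, hinj⟩ : (Σ i, Fin (n i + 1)) ↪ V) b) := by
      rintro _ _ ⟨a, i, j, rfl, rfl, hij⟩
      have hij' : j.val = i.val + 1 := hij
      obtain ⟨u, v, hu, hv, huv⟩ := hlen1 (e (σ a)).1.val i.val (by
        have := j.isLt
        have : n a = len (e (σ a)).1.val := rfl
        omega)
      convert huv
      · rw [Function.Embedding.coeFn_mk, Equiv.symm_apply_eq]
        apply Fin.ext
        dsimp only
        omega
      · rw [Function.Embedding.coeFn_mk, Equiv.symm_apply_eq]
        apply Fin.ext
        dsimp only
        omega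
    ext u v
    rw [SimpleGraph.map_adj]
    constructor
    · intro huv
      rcases hH u v huv with h | h
      · obtain ⟨a, b, hab, ha, hb⟩ := key u v h huv
        exact ⟨a, b, Or.inl hab, ha, hb⟩
      · obtain ⟨a, b, hab, ha, hb⟩ := key v u h huv.symm
        exact ⟨b, a, Or.inr hab, hb, ha⟩
    · rintro ⟨a, b, hab | hab, rfl, rfl⟩
      · exact key2 a b hab
      · exact (key2 b a hab).symm

theorem SimpleGraph.reachable_map_iff {A B : Type*} (G : SimpleGraph A) (φ : A ↪ B) (a : A)
    (w : B) : (G.map φ).Reachable (φ a) w ↔ ∃ b, φ b = w ∧ G.Reachable a b := by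
  constructor
  · rintro ⟨p⟩
    generalize hu : φ a = u at p
    induction p generalizing a with
    | nil => exact ⟨a, hu, SimpleGraph.Reachable.refl a⟩
    | cons h p ih =>
      subst hu
      obtain ⟨a', b', hab, ha, rfl⟩ := (SimpleGraph.map_adj _ _ _ _).mp h
      obtain rfl := φ.injective ha
      obtain ⟨c, hc, hbc⟩ := ih b' rfl
      exact ⟨c, hc, hab.reachable.trans hbc⟩
  · rintro ⟨b, rfl, h⟩
    exact h.map (SimpleGraph.Embedding.map φ G).toHom

/-! ### Uniqueness of the path lengths -/

namespace OrientedGraph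

theorem underlying_pathQ (m : ℕ) : (pathQ m).underlying = (dirPath (2 * m)).underlying := by
  obtain ⟨R, hR, -, h⟩ := pathQ_eq_reverse m
  rw [h, underlying_reverse hR]

theorem underlying_disjUnion_adj {ι : Type*} {V : ι → Type*} (G : ∀ i, OrientedGraph (V i))
    (a b : Σ i, V i) : (disjUnion G).underlying.Adj a b ↔
      ∃ i u v, a = ⟨i, u⟩ ∧ b = ⟨i, v⟩ ∧ (G i).underlying.Adj u v := by
  constructor
  · rintro (⟨i, u, v, h1, h2, h⟩ | ⟨i, u, v, h1, h2, h⟩)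
    · exact ⟨i, u, v, h1, h2, Or.inl h⟩
    · exact ⟨i, v, u, h2, h1, Or.inr h⟩
  · rintro ⟨i, u, v, h1, h2, h | h⟩
    · exact Or.inl ⟨i, u, v, h1, h2, h⟩
    · exact Or.inr ⟨i, v, u, h2, h1, h⟩

theorem underlying_disjUnion_congr {ι : Type*} {V : ι → Type*} {G G' : ∀ i, OrientedGraph (V i)}
    (h : ∀ i, (G i).underlying = (G' i).underlying) :
    (disjUnion G).underlying = (disjUnion G').underlying := by
  ext a b
  simp only [underlying_disjUnion_adj, h]

theorem dirPath_reachable (n : ℕ) (a b : Fin (n + 1)) : (dirPath n).underlying.Reachable a b := by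
  have h0 : ∀ (i : ℕ) (hi : i < n + 1), (dirPath n).underlying.Reachable 0 ⟨i, hi⟩ := by
    intro i
    induction i with
    | zero => exact fun _ => SimpleGraph.Reachable.refl _
    | succ i ih =>
      intro hi
      refine (ih (by omega)).trans (SimpleGraph.Adj.reachable ?_)
      exact Or.inl rfl
  exact (h0 a.val a.isLt).symm.trans (h0 b.val b.isLt)

theorem disjUnion_dirPath_reachable {k : ℕ} (n : Fin k → ℕ) (a b : Σ i, Fin (n i + 1)) :
    (disjUnion fun i => dirPath (n i)).underlying.Reachable a b ↔ a.1 = b.1 := by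
  constructor
  · rintro ⟨p⟩
    induction p with
    | nil => rfl
    | cons h p ih =>
      obtain ⟨i, u, v, rfl, rfl, -⟩ := (underlying_disjUnion_adj _ _ _).mp h
      exact ih
  · obtain ⟨i, a⟩ := a
    obtain ⟨j, b⟩ := b
    rintro h
    dsimp only at h
    subst h
    let f : (dirPath (n i)).underlying →g (disjUnion fun i => dirPath (n i)).underlying :=
      ⟨fun u => ⟨i, u⟩, fun {u v} h =>
        (underlying_disjUnion_adj _ _ _).mpr ⟨i, u, v, rfl, rfl, h⟩⟩
    exact (dirPath_reachable (n i) a b).map f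

theorem ncard_reachable_map {V : Type*} {k : ℕ} {n : Fin k → ℕ}
    (φ : (Σ i, Fin (n i + 1)) ↪ V) (a : Σ i, Fin (n i + 1)) :
    {w | ((disjUnion fun i => dirPath (n i)).underlying.map φ).Reachable (φ a) w}.ncard =
      n a.1 + 1 := by
  have : {w | ((disjUnion fun i => dirPath (n i)).underlying.map φ).Reachable (φ a) w} =
      (fun b : Fin (n a.1 + 1) => φ ⟨a.1, b⟩) '' Set.univ := by
    ext w
    simp only [Set.mem_ofPred_eq, SimpleGraph.reachable_map_iff, disjUnion_dirPath_reachable,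
      Set.image_univ, Set.mem_range]
    constructor
    · rintro ⟨⟨j, b⟩, rfl, h⟩
      dsimp only at h
      subst h
      exact ⟨b, rfl⟩
    · rintro ⟨b, rfl⟩
      exact ⟨_, rfl, rfl⟩
  rw [this, Set.ncard_image_of_injective _ fun b c h => by simpa using φ.injective h,
    Set.ncard_univ, Nat.card_fin]

theorem ncard_reachable_map_of_notMem {V : Type*} {A : Type*} {G : SimpleGraph A}
    (φ : A ↪ V) {v : V} (hv : v ∉ Set.range φ) : {w | (G.map φ).Reachable v w}.ncard = 1 := by
  rw [Set.ncard_eq_one]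
  refine ⟨v, Set.eq_singleton_iff_unique_mem.mpr ⟨SimpleGraph.Reachable.refl v, ?_⟩⟩
  rintro w ⟨p⟩
  cases p with
  | nil => rfl
  | cons h p =>
    obtain ⟨a, b, -, rfl, -⟩ := (SimpleGraph.map_adj _ _ _ _).mp h
    exact absurd ⟨a, rfl⟩ hv

/-- The sizes of the paths in a union of paths are determined by the graph. -/
theorem card_filter_eq_of_map_eq {V : Type*} [Fintype V] {k k' : ℕ} {n : Fin k → ℕ}
    {n' : Fin k' → ℕ} (φ : (Σ i, Fin (n i + 1)) ↪ V) (φ' : (Σ i, Fin (n' i + 1)) ↪ V)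
    (h : (disjUnion fun i => dirPath (n i)).underlying.map φ =
      (disjUnion fun i => dirPath (n' i)).underlying.map φ') {m : ℕ} (hm : 1 ≤ m) :
    (Finset.univ.filter fun i => n i = m).card = (Finset.univ.filter fun i => n' i = m).card := by
  classical
  -- A path with m edges is a component with m+1 vertices, so the vertices lying in components of
  -- that size number m+1 times the paths of length m. As m ≥ 1, isolated vertices are not counted.
  have key : ∀ {k : ℕ} {n : Fin k → ℕ} (φ : (Σ i, Fin (n i + 1)) ↪ V),
      (Finset.univ.filter fun v => {w | ((disjUnion fun i => dirPath (n i)).underlying.map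
        φ).Reachable v w}.ncard = m + 1).card = (Finset.univ.filter fun i => n i = m).card *
          (m + 1) := by
    intro k n φ
    have : (Finset.univ.filter fun v => {w | ((disjUnion fun i => dirPath (n i)).underlying.map
        φ).Reachable v w}.ncard = m + 1) =
        ((Finset.univ.filter fun i => n i = m).sigma fun _ => Finset.univ).map φ := by
      ext v
      simp only [Finset.mem_filter, Finset.mem_univ, true_and, Finset.mem_map, Finset.mem_sigma,
        and_true]
      constructor
      · intro hv
        by_cases hr : v ∈ Set.range φ
        · obtain ⟨a, rfl⟩ := hr
          rw [ncard_reachable_map] at hv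
          exact ⟨a, by omega, rfl⟩
        · rw [ncard_reachable_map_of_notMem φ hr] at hv
          omega
      · rintro ⟨a, ha, rfl⟩
        rw [ncard_reachable_map, ha]
    rw [this, Finset.card_map, Finset.card_sigma, Finset.sum_const_nat]
    intro i hi
    rw [Finset.card_univ, Fintype.card_fin, (Finset.mem_filter.mp hi).2]
  have h1 := key φ
  have h2 := key φ'
  rw [h, h2] at h1
  exact (Nat.eq_of_mul_eq_mul_right (by omega) h1).symm

/-- Equal multiplicities make the tuples permutations of each other, and both are sorted. -/
theorem sigma_eq_of_card_filter_eq {k k' : ℕ} {n : Fin k → ℕ} {n' : Fin k' → ℕ}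
    (hn : Monotone n) (hn' : Monotone n') (hn1 : ∀ i, 1 ≤ n i) (hn1' : ∀ i, 1 ≤ n' i)
    (h : ∀ m, 1 ≤ m → (Finset.univ.filter fun i => n i = m).card =
      (Finset.univ.filter fun i => n' i = m).card) :
    (⟨k, n⟩ : Σ k, Fin k → ℕ) = ⟨k', n'⟩ := by
  have hcount : ∀ {k : ℕ} (n : Fin k → ℕ) (m : ℕ),
      (List.ofFn n).count m = (Finset.univ.filter fun i => n i = m).card := by
    intro k n m
    rw [← Multiset.coe_count, ← Fin.univ_val_map, Multiset.count_map, Finset.card_def,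
      Finset.filter_val]
    simp only [eq_comm]
  have hperm : (List.ofFn n).Perm (List.ofFn n') := by
    rw [List.perm_iff_count]
    intro m
    rw [hcount, hcount]
    rcases Nat.eq_zero_or_pos m with rfl | hm
    · rw [Finset.filter_false_of_mem fun i _ => by have := hn1 i; omega,
        Finset.filter_false_of_mem fun i _ => by have := hn1' i; omega]
      rfl
    · exact h m hm
  have heq : List.ofFn n = List.ofFn n' :=
    hperm.eq_of_pairwise' (r := (· ≤ ·)) (List.pairwise_ofFn.mpr fun _ _ h => hn h.le)
      (List.pairwise_ofFn.mpr fun _ _ h => hn' h.le)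
  exact List.ofFn_inj'.mp heq

theorem sigma_eq_of_map_eq {V : Type*} [Fintype V] {k k' : ℕ} {n : Fin k → ℕ}
    {n' : Fin k' → ℕ} (hn : Monotone n) (hn' : Monotone n') (hn1 : ∀ i, 1 ≤ n i)
    (hn1' : ∀ i, 1 ≤ n' i) (φ : (Σ i, Fin (2 * n i + 1)) ↪ V)
    (φ' : (Σ i, Fin (2 * n' i + 1)) ↪ V)
    (h : (disjUnion fun i => pathQ (n i)).underlying.map φ =
      (disjUnion fun i => pathQ (n' i)).underlying.map φ') :
    (⟨k, n⟩ : Σ k, Fin k → ℕ) = ⟨k', n'⟩ := by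
  rw [underlying_disjUnion_congr fun i => underlying_pathQ (n i),
    underlying_disjUnion_congr fun i => underlying_pathQ (n' i)] at h
  refine sigma_eq_of_card_filter_eq hn hn' hn1 hn1' fun m hm => ?_
  have := card_filter_eq_of_map_eq φ φ' h (m := 2 * m) (by omega)
  simpa using this

end OrientedGraph

/-! ### Expansion of the density of an oriented cycle -/

namespace OrientedGraph

variable {U : unitInterval × unitInterval → ℝ}

theorem fin_val_sub_eq_one_iff {ℓ : ℕ} (h3 : 3 ≤ ℓ) (a b : Fin ℓ) :
    (b - a).val = 1 ↔ b.val = a.val + 1 ∨ (a.val + 1 = ℓ ∧ b.val = 0) := by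
  have ha := a.isLt
  have hb := b.isLt
  rw [Fin.sub_def]
  dsimp only
  rcases Nat.lt_or_ge (ℓ - a.val + b.val) ℓ with h | h
  · rw [Nat.mod_eq_of_lt h]
    omega
  · rw [Nat.mod_eq_sub_mod h, Nat.mod_eq_of_lt (by omega)]
    omega

theorem cycleGraph_eq_underlying_dirCycle {ℓ : ℕ} (h3 : 3 ≤ ℓ) :
    SimpleGraph.cycleGraph ℓ = (dirCycle ℓ h3).underlying := by
  ext a b
  rw [SimpleGraph.cycleGraph_adj', fin_val_sub_eq_one_iff h3, fin_val_sub_eq_one_iff h3, or_comm]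
  rfl

section Cycle

variable {V : Type*} [Fintype V] {C : OrientedGraph V} {ℓ : ℕ}

theorem IsCycleOrientation.exists_underlying_eq_map (hC : C.IsCycleOrientation ℓ) :
    ∃ ψ : Fin ℓ ≃ V, C.underlying = (dirCycle ℓ hC.1).underlying.map ψ.toEmbedding := by
  obtain ⟨h3, ⟨e⟩⟩ := hC
  refine ⟨e.symm.toEquiv, ?_⟩
  rw [← cycleGraph_eq_underlying_dirCycle]
  ext u v
  rw [SimpleGraph.map_adj]
  constructor
  · intro h
    exact ⟨e u, e v, e.map_adj_iff.mpr h, e.symm_apply_apply u, e.symm_apply_apply v⟩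
  · rintro ⟨a, b, hab, rfl, rfl⟩
    exact e.symm.map_adj_iff.mpr hab

theorem IsCycleOrientation.card_eq (hC : C.IsCycleOrientation ℓ) : Fintype.card V = ℓ := by
  obtain ⟨ψ, -⟩ := hC.exists_underlying_eq_map
  rw [← Fintype.card_congr ψ, Fintype.card_fin]

theorem IsCycleOrientation.card_edges (hC : C.IsCycleOrientation ℓ) : C.edges.card = ℓ := by
  obtain ⟨ψ, h⟩ := hC.exists_underlying_eq_map
  obtain ⟨R, hR, hadj⟩ := exists_reverse_of_underlying_eq_map h
  rw [IsIsoAddIsolated.card_edges ⟨_, hadj⟩, card_edges_reverse hR, card_edges_dirCycle]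

theorem IsIso.isIsoAddIsolated {A B : Type*} {G : OrientedGraph A} {H : OrientedGraph B}
    (h : IsIso G H) : IsIsoAddIsolated G H := by
  obtain ⟨φ, hφ⟩ := h
  refine ⟨φ.toEmbedding, fun u v => ⟨fun huv => ?_, ?_⟩⟩
  · refine ⟨φ.symm u, φ.symm v, φ.apply_symm_apply u, φ.apply_symm_apply v, ?_⟩
    rwa [← hφ, φ.apply_symm_apply, φ.apply_symm_apply]
  · rintro ⟨a, b, rfl, rfl, hab⟩
    exact (hφ a b).mpr hab

theorem IsCycleOrientation.exists_isIso_reverse_cycleD (hC : C.IsCycleOrientation ℓ)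
    (hℓ : Even ℓ) : ∃ R ⊆ (cycleD (ℓ / 2)).edges, IsIso ((cycleD (ℓ / 2)).reverse R) C := by
  obtain ⟨m, rfl⟩ := hℓ.two_dvd
  have h3 := hC.1
  obtain ⟨ψ, h⟩ := hC.exists_underlying_eq_map
  obtain ⟨R, hR, -, hD⟩ := cycleD_eq_reverse h3
  rw [← underlying_reverse hR, ← hD] at h
  rw [show 2 * m / 2 = m by omega]
  obtain ⟨R', hR', hadj⟩ := exists_reverse_of_underlying_eq_map h
  refine ⟨R', hR', ψ, fun a b => ?_⟩
  rw [hadj]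
  constructor
  · rintro ⟨a', b', ha, hb, hab⟩
    obtain rfl := ψ.injective ha
    obtain rfl := ψ.injective hb
    exact hab
  · exact fun hab => ⟨a, b, rfl, rfl, hab⟩

theorem IsCycleOrientation.density_eq_gamma_mul (hC : C.IsCycleOrientation ℓ) (hℓ : Even ℓ)
    (hU : IsSkewKernel U) :
    C.density U = C.gamma ℓ * (cycleD (ℓ / 2)).density U := by
  classical
  rw [gamma]
  split_ifs with h
  · obtain ⟨R, hR, he, hiso⟩ := h
    rw [hiso.isIsoAddIsolated.density_eq hU.toBddMeasurable, density_reverse hR hU, he.neg_one_pow]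
    simp
  · obtain ⟨R, hR, hiso⟩ := hC.exists_isIso_reverse_cycleD hℓ
    have ho : Odd R.card := by
      rw [← Nat.not_even_iff_odd]
      exact fun he => h ⟨R, hR, he, hiso⟩
    rw [hiso.isIsoAddIsolated.density_eq hU.toBddMeasurable, density_reverse hR hU, ho.neg_one_pow]
    simp

/-- A proper spanning subgraph of a cycle is a disjoint union of paths. -/
theorem IsCycleOrientation.exists_paths (hC : C.IsCycleOrientation ℓ) {F : Finset (V × V)}
    (hF : F ⊂ C.edges) :
    ∃ (k : ℕ) (n : Fin k → ℕ) (φ : (Σ i, Fin (n i + 1)) ↪ V), Monotone n ∧ (∀ i, 1 ≤ n i) ∧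
      (C.spanning F).underlying = (disjUnion fun i => dirPath (n i)).underlying.map φ := by
  obtain ⟨h3, ⟨e⟩⟩ := hC
  have : NeZero ℓ := ⟨by omega⟩
  have hsub : ∀ a b, (C.spanning F).underlying.Adj a b →
      (e a - e b).val = 1 ∨ (e b - e a).val = 1 := by
    intro a b hab
    rw [← SimpleGraph.cycleGraph_adj']
    refine e.map_adj_iff.mpr ?_
    exact hab.imp (fun h => h.1) fun h => h.1
  -- The cycle is cut open at a missing edge pq. Numbering vertices from q, the only edge of the
  -- cycle that wraps around is pq, so all remaining edges join consecutive numbers.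
  obtain ⟨p, q, hpq, hnot⟩ : ∃ p q, (e q - e p).val = 1 ∧ ¬(C.spanning F).underlying.Adj p q := by
    obtain ⟨⟨u, v⟩, huv, huF⟩ := Finset.exists_of_ssubset hF
    have hadj : C.Adj u v := mem_edges.mp huv
    have hn : ¬(C.spanning F).underlying.Adj u v := by
      rintro (h | h)
      · exact huF h.2
      · exact C.asymm _ _ hadj h.1
    have := e.map_adj_iff.mpr (show C.underlying.Adj u v from Or.inl hadj)
    rw [SimpleGraph.cycleGraph_adj'] at this
    rcases this with h | h
    · exact ⟨v, u, h, fun h' => hn h'.symm⟩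
    · exact ⟨u, v, h, hn⟩
  have hstep : ∀ a b, (C.spanning F).underlying.Adj a b → (e b - e a).val = 1 →
      (e b - e q).val = (e a - e q).val + 1 := by
    intro a b hab h
    have h1 : e b - e a = (e b - e q) - (e a - e q) := by abel
    rw [h1, fin_val_sub_eq_one_iff h3] at h
    rcases h with h | ⟨h, h'⟩
    · exact h
    · exfalso
      have hb : e b = e q := sub_eq_zero.mp (Fin.ext (by simpa using h'))
      have ha : e a = e p := by
        have hone : e b - e a = e q - e p := by
          apply Fin.ext
          rw [hpq, h1, fin_val_sub_eq_one_iff h3]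
          exact Or.inr ⟨h, h'⟩
        rw [hb] at hone
        exact sub_right_injective hone
      rw [e.injective ha, e.injective hb] at hab
      exact hnot hab
  refine SimpleGraph.exists_runs _ (e.toEquiv.trans (Equiv.subRight (e q))) fun a b hab => ?_
  rcases hsub a b hab with h | h
  · exact Or.inr (hstep b a hab.symm h)
  · exact Or.inl (hstep a b hab h)

/-- The spanning subgraph of `C` with edge set `F` is, up to reversing edges and adding isolated
vertices, a union of paths of lengths `2 n i`. -/
def IsPathUnion (C : OrientedGraph V) (F : Finset (V × V)) {k : ℕ} (n : Fin k → ℕ) : Prop :=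
  ∃ R ⊆ (disjUnion fun i => pathQ (n i)).edges,
    IsIsoAddIsolated ((disjUnion fun i => pathQ (n i)).reverse R) (C.spanning F)

/-- `IsPathUnion` with an even number of reversed edges. -/
def IsEvenPathUnion (C : OrientedGraph V) (F : Finset (V × V)) {k : ℕ} (n : Fin k → ℕ) : Prop :=
  ∃ R ⊆ (disjUnion fun i => pathQ (n i)).edges, Even R.card ∧
    IsIsoAddIsolated ((disjUnion fun i => pathQ (n i)).reverse R) (C.spanning F)

/-- `IsPathUnion` with an odd number of reversed edges. -/
def IsOddPathUnion (C : OrientedGraph V) (F : Finset (V × V)) {k : ℕ} (n : Fin k → ℕ) : Prop :=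
  ∃ R ⊆ (disjUnion fun i => pathQ (n i)).edges, Odd R.card ∧
    IsIsoAddIsolated ((disjUnion fun i => pathQ (n i)).reverse R) (C.spanning F)

variable {F : Finset (V × V)} {k : ℕ} {n : Fin k → ℕ}

theorem isPathUnion_iff : C.IsPathUnion F n ↔ C.IsEvenPathUnion F n ∨ C.IsOddPathUnion F n := by
  constructor
  · rintro ⟨R, hR, h⟩
    rcases Nat.even_or_odd R.card with he | ho
    · exact Or.inl ⟨R, hR, he, h⟩
    · exact Or.inr ⟨R, hR, ho, h⟩
  · rintro (⟨R, hR, -, h⟩ | ⟨R, hR, -, h⟩) <;> exact ⟨R, hR, h⟩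

theorem density_disjUnion_pathQ (hU : IsSkewKernel U) (n : Fin k → ℕ) :
    (disjUnion fun i => pathQ (n i)).density U = ∏ i, pathNorm U (n i) := by
  rw [density_disjUnion _ hU.toBddMeasurable]
  simp only [density_pathQ hU]

theorem IsEvenPathUnion.density_eq (h : C.IsEvenPathUnion F n) (hU : IsSkewKernel U) :
    (C.spanning F).density U = ∏ i, pathNorm U (n i) := by
  obtain ⟨R, hR, he, h⟩ := h
  rw [h.density_eq hU.toBddMeasurable, density_reverse hR hU, he.neg_one_pow, one_mul,
    density_disjUnion_pathQ hU]

theorem IsOddPathUnion.density_eq (h : C.IsOddPathUnion F n) (hU : IsSkewKernel U) :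
    (C.spanning F).density U = -∏ i, pathNorm U (n i) := by
  obtain ⟨R, hR, ho, h⟩ := h
  rw [h.density_eq hU.toBddMeasurable, density_reverse hR hU, ho.neg_one_pow, neg_one_mul,
    density_disjUnion_pathQ hU]

theorem IsPathUnion.card_edges (h : C.IsPathUnion F n) (hF : F ⊆ C.edges) :
    F.card = ∑ i, 2 * n i := by
  obtain ⟨R, hR, h⟩ := h
  rw [← edges_spanning hF, h.card_edges, card_edges_reverse hR, card_edges_disjUnion]
  simp only [card_edges_pathQ]

theorem IsPathUnion.card_le (h : C.IsPathUnion F n) : k + ∑ i, 2 * n i ≤ Fintype.card V := by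
  obtain ⟨R, hR, φ, -⟩ := h
  have := Fintype.card_le_of_embedding φ
  simp only [Fintype.card_sigma, Fintype.card_fin, Finset.sum_add_distrib, Finset.sum_const,
    Finset.card_univ, smul_eq_mul, mul_one] at this
  omega

theorem isPathUnion_iff_underlying : C.IsPathUnion F n ↔
    ∃ φ : (Σ i, Fin (2 * n i + 1)) ↪ V,
      (C.spanning F).underlying = (disjUnion fun i => pathQ (n i)).underlying.map φ := by
  constructor
  · rintro ⟨R, hR, φ, h⟩
    exact ⟨φ, by rw [underlying_eq_map_of_embedding h, underlying_reverse hR]⟩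
  · rintro ⟨φ, h⟩
    obtain ⟨R, hR, hadj⟩ := exists_reverse_of_underlying_eq_map h
    exact ⟨R, hR, φ, hadj⟩

open Classical in
/-- The contribution of the edge set `F` to `alpha C n`. -/
noncomputable def pathSign (C : OrientedGraph V) (F : Finset (V × V)) {k : ℕ} (n : Fin k → ℕ) :
    ℤ :=
  (if C.IsEvenPathUnion F n then 1 else 0) - (if C.IsOddPathUnion F n then 1 else 0)

theorem alpha_eq_sum_pathSign (C : OrientedGraph V) (n : Fin k → ℕ) :
    C.alpha n = ∑ F ∈ C.edges.powerset, C.pathSign F n := by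
  classical
  simp only [pathSign, Finset.sum_sub_distrib, Finset.sum_boole]
  exact congrArg₂ (fun a b : ℕ => (a : ℤ) - b)
    (congrArg Finset.card (Finset.filter_congr fun F _ => by rw [IsEvenPathUnion]))
    (congrArg Finset.card (Finset.filter_congr fun F _ => by rw [IsOddPathUnion]))

theorem pathSign_of_not (h : ¬C.IsPathUnion F n) : C.pathSign F n = 0 := by
  rw [isPathUnion_iff, not_or] at h
  simp [pathSign, h.1, h.2]

theorem IsPathUnion.pathSign_mul (h : C.IsPathUnion F n) (hU : IsSkewKernel U) :
    C.pathSign F n * ∏ i, pathNorm U (n i) = (C.spanning F).density U := by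
  rw [isPathUnion_iff] at h
  by_cases he : C.IsEvenPathUnion F n <;> by_cases ho : C.IsOddPathUnion F n
  -- If both parities occurred, the product would equal its own negative; the contribution 0 is then
  -- still correct. Uniqueness of the parity need not be proved.
  · have h1 := he.density_eq hU
    have h2 := ho.density_eq hU
    simp only [pathSign, he, ho, if_true]
    push_cast
    linarith
  · simp [pathSign, he, ho, he.density_eq hU]
  · simp [pathSign, he, ho, ho.density_eq hU]
  · tauto

/-- The union of paths has more vertices than the cycle. This is needed for Q_4 in a cycle of length
4. -/
theorem alpha_eq_zero (h : Fintype.card V < k + ∑ i, 2 * n i) : C.alpha n = 0 := by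
  rw [alpha_eq_sum_pathSign]
  refine Finset.sum_eq_zero fun F _ => pathSign_of_not fun hF => ?_
  have := hF.card_le
  omega

theorem mem_tuples {ℓ k : ℕ} {n : Fin k → ℕ} :
    n ∈ tuples ℓ k ↔ (∀ i, 1 ≤ n i) ∧ Monotone n ∧ k + ∑ i, 2 * n i ≤ ℓ := by
  classical
  simp only [tuples, Finset.mem_filter, Fintype.mem_piFinset, Finset.mem_Icc]
  constructor
  · rintro ⟨h1, h2, h3⟩
    exact ⟨fun i => (h1 i).1, h2, h3⟩
  · rintro ⟨h1, h2, h3⟩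
    refine ⟨fun i => ⟨h1 i, ?_⟩, h2, h3⟩
    have : 2 * n i ≤ ∑ i, 2 * n i := Finset.single_le_sum (f := fun i => 2 * n i)
      (fun _ _ => Nat.zero_le _) (Finset.mem_univ i)
    omega

theorem density_spanning_empty : (C.spanning ∅).density U = 1 := by
  rw [density, edges_spanning (Finset.empty_subset _)]
  simp

theorem spanning_edges : C.spanning C.edges = C :=
  ext_adj fun _ _ => ⟨fun h => h.1, fun h => ⟨h, mem_edges.mpr h⟩⟩

-- Uniform formula for the density of every spanning subgraph: at most one summand is nonzero,
-- because the path lengths determine the tuple. If no tuple fits, some path is odd and the density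
-- is 0.
open Classical in
theorem IsCycleOrientation.density_spanning (hC : C.IsCycleOrientation ℓ) (hU : IsSkewKernel U)
    (hF : F ⊆ C.edges) :
    (C.spanning F).density U = (if F = ∅ then 1 else 0) +
      (if F = C.edges then C.density U else 0) +
      ∑ p ∈ (Finset.Icc 1 ℓ).sigma (tuples ℓ),
        C.pathSign F p.2 * ∏ i, pathNorm U (p.2 i) := by
  have h3 := hC.1
  have hne : C.edges ≠ ∅ := by
    intro h
    have := hC.card_edges
    rw [h, Finset.card_empty] at this
    omega
  have hzero : (∀ p ∈ (Finset.Icc 1 ℓ).sigma (tuples ℓ), ¬C.IsPathUnion F p.2) →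
      ∑ p ∈ (Finset.Icc 1 ℓ).sigma (tuples ℓ),
        (C.pathSign F p.2 : ℝ) * ∏ i, pathNorm U (p.2 i) = 0 := fun h =>
    Finset.sum_eq_zero fun p hp => by rw [pathSign_of_not (h p hp), Int.cast_zero, zero_mul]
  by_cases h0 : F = ∅
  · subst h0
    rw [hzero, density_spanning_empty, if_pos rfl, if_neg hne.symm]
    · ring
    · intro p hp hu
      rw [Finset.mem_sigma, Finset.mem_Icc, mem_tuples] at hp
      have hcard := hu.card_edges hF
      rw [Finset.card_empty] at hcard
      have hle : 2 * p.2 ⟨0, hp.1.1⟩ ≤ ∑ i, 2 * p.2 i :=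
        Finset.single_le_sum (f := fun i => 2 * p.2 i) (fun _ _ => Nat.zero_le _)
          (Finset.mem_univ (⟨0, hp.1.1⟩ : Fin p.1))
      have := hp.2.1 ⟨0, hp.1.1⟩
      omega
  by_cases h1 : F = C.edges
  · subst h1
    rw [hzero, spanning_edges, if_neg hne, if_pos rfl]
    · ring
    · intro p hp hu
      rw [Finset.mem_sigma, Finset.mem_Icc, mem_tuples] at hp
      have hcard := hu.card_edges hF
      -- All ℓ edges cannot form k ≥ 1 paths, since those would need ℓ + k vertices.
      rw [hC.card_edges] at hcard
      omega
  rw [if_neg h0, if_neg h1, zero_add, zero_add]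
  by_cases hu : ∃ p ∈ (Finset.Icc 1 ℓ).sigma (tuples ℓ), C.IsPathUnion F p.2
  · obtain ⟨p, hp, hu⟩ := hu
    rw [Finset.sum_eq_single p, hu.pathSign_mul hU]
    · intro p' hp' hne
      rw [pathSign_of_not, Int.cast_zero, zero_mul]
      intro hu'
      apply hne
      rw [Finset.mem_sigma, mem_tuples] at hp hp'
      obtain ⟨φ, hφ⟩ := isPathUnion_iff_underlying.mp hu
      obtain ⟨φ', hφ'⟩ := isPathUnion_iff_underlying.mp hu'
      exact sigma_eq_of_map_eq hp'.2.2.1 hp.2.2.1 hp'.2.1 hp.2.1 φ' φ (hφ'.symm.trans hφ)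
    · exact fun h => absurd hp h
  · push Not at hu
    rw [hzero hu]
    obtain ⟨k, n, φ, hn, hn1, hmap⟩ :=
      hC.exists_paths (Finset.ssubset_iff_subset_ne.mpr ⟨hF, h1⟩)
    -- Either an odd path annihilates the density, or all lengths are even and halving them yields a
    -- tuple excluded by `hu`.
    by_cases hodd : ∃ i, Odd (n i)
    · obtain ⟨i, hi⟩ := hodd
      obtain ⟨R, hR, hadj⟩ := exists_reverse_of_underlying_eq_map hmap
      rw [IsIsoAddIsolated.density_eq ⟨φ, hadj⟩ hU.toBddMeasurable, density_reverse hR hU,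
        density_disjUnion _ hU.toBddMeasurable,
        Finset.prod_eq_zero (Finset.mem_univ i) (density_dirPath_odd hU hi), mul_zero]
    · exfalso
      push Not at hodd
      have hev : ∀ i, ∃ m, n i = 2 * m := fun i =>
        (Nat.not_odd_iff_even.mp (hodd i)).two_dvd
      choose m hm using hev
      obtain rfl : n = fun i => 2 * m i := funext hm
      have hpu : C.IsPathUnion F m := isPathUnion_iff_underlying.mpr ⟨φ, by
        rw [hmap, underlying_disjUnion_congr fun i => underlying_pathQ (m i)]⟩
      have hm1 : ∀ i, 1 ≤ m i := fun i => by have : 1 ≤ 2 * m i := hn1 i; omega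
      have hcard := hpu.card_le
      rw [hC.card_eq] at hcard
      have hk : 1 ≤ k := by
        by_contra hk
        obtain rfl : k = 0 := by omega
        have := hpu.card_edges hF
        simp [h0] at this
      refine hu ⟨k, m⟩ ?_ hpu
      rw [Finset.mem_sigma, Finset.mem_Icc, mem_tuples]
      have hkℓ : k ≤ ℓ := by omega
      refine ⟨⟨hk, hkℓ⟩, hm1, fun i j hij => ?_, hcard⟩
      have : 2 * m i ≤ 2 * m j := hn hij
      exact Nat.le_of_mul_le_mul_left this two_pos

theorem density_add_const {V : Type*} [Fintype V] (C : OrientedGraph V) (hU : BddMeasurable U)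
    (c : ℝ) : C.density (fun p => U p + c) =
      ∑ F ∈ C.edges.powerset, (C.spanning F).density U * c ^ (C.edges.card - F.card) := by
  classical
  simp only [density, Finset.prod_add, Finset.prod_const]
  rw [integral_finsetSum]
  · refine Finset.sum_congr rfl fun F hF => ?_
    rw [Finset.mem_powerset] at hF
    rw [integral_mul_const, edges_spanning hF, Finset.card_sdiff_of_subset hF]
  · exact fun F _ => ((bddMeasurable_prod_edges hU F).mul (BddMeasurable.const _)).integrable _

/-- The expansion of the density of an oriented even cycle around `1/2`. -/
theorem IsCycleOrientation.density_expansion (hC : C.IsCycleOrientation ℓ) (hℓ : Even ℓ)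
    (hU : IsSkewKernel U) :
    C.density (fun p => U p + 1 / 2) = 1 / 2 ^ ℓ + C.gamma ℓ * (cycleD (ℓ / 2)).density U +
      ∑ k ∈ Finset.Icc 1 ℓ, ∑ n ∈ tuples ℓ k,
        C.alpha n * (∏ i, pathNorm U (n i)) / 2 ^ (ℓ - ∑ i, 2 * n i) := by
  classical
  rw [density_add_const C hU.toBddMeasurable, hC.card_edges, ← hC.density_eq_gamma_mul hℓ hU]
  have hterm : ∀ F ∈ C.edges.powerset,
      (C.spanning F).density U * (1 / 2 : ℝ) ^ (ℓ - F.card) =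
      (if F = ∅ then 1 / 2 ^ ℓ else 0) + (if F = C.edges then C.density U else 0) +
      ∑ p ∈ (Finset.Icc 1 ℓ).sigma (tuples ℓ),
        C.pathSign F p.2 * ((∏ i, pathNorm U (p.2 i)) / 2 ^ (ℓ - ∑ i, 2 * p.2 i)) := by
    intro F hF
    rw [Finset.mem_powerset] at hF
    rw [hC.density_spanning hU hF, add_mul, add_mul, Finset.sum_mul]
    congr 1
    · congr 1
      · split_ifs with h
        · simp [h]
        · simp
      · split_ifs with h
        · simp [h, hC.card_edges]
        · simp
    · refine Finset.sum_congr rfl fun p _ => ?_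
      by_cases hu : C.IsPathUnion F p.2
      · rw [hu.card_edges hF, one_div, inv_pow]
        ring
      · rw [pathSign_of_not hu]
        simp
  rw [Finset.sum_congr rfl hterm, Finset.sum_add_distrib, Finset.sum_add_distrib,
    Finset.sum_ite_eq', Finset.sum_ite_eq', if_pos (Finset.empty_mem_powerset _),
    if_pos (Finset.mem_powerset_self _), Finset.sum_comm, Finset.sum_sigma]
  congr 1
  refine Finset.sum_congr rfl fun k _ => Finset.sum_congr rfl fun n _ => ?_
  rw [alpha_eq_sum_pathSign, ← Finset.sum_mul]
  push_cast
  ring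

end Cycle

end OrientedGraph

/-! ### Estimating the path terms -/

namespace OrientedGraph

/-- A positive coefficient is discarded; for a negative one the product P is replaced by its upper
bound q/B. -/
theorem min_mul_div_le {a b B D P q : ℝ} (hB : 0 < B) (hD : 0 < D) (hP : 0 ≤ P) (hPq : P ≤ q / B)
    (hb : b = B * D) : q * (min 0 a / b) ≤ a * P / D := by
  subst hb
  have h1 : min 0 a * (q / B) ≤ a * P :=
    (mul_le_mul_of_nonpos_left hPq (min_le_left 0 a)).trans
      (mul_le_mul_of_nonneg_right (min_le_right 0 a) hP)
  calc q * (min 0 a / (B * D)) = min 0 a * (q / B) / D := by field_simp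
    _ ≤ a * P / D := div_le_div_of_nonneg_right h1 hD.le

section Coefficients

variable {q : ℕ → ℝ}

theorem prod_le_of_all_one (hq0 : ∀ m, 0 ≤ q m) (hq1 : q 1 ≤ 1 / 12) {k : ℕ} (hk : 1 ≤ k)
    {n : Fin k → ℕ} (hn : ∀ i, n i = 1) : ∏ i, q (n i) ≤ q 1 / 12 ^ (k - 1) := by
  obtain ⟨k, rfl⟩ := Nat.exists_eq_add_of_le' hk
  simp only [hn, Finset.prod_const, Finset.card_univ, Fintype.card_fin, Nat.add_sub_cancel]
  rw [pow_succ', div_eq_mul_inv, ← inv_pow]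
  refine mul_le_mul_of_nonneg_left ?_ (hq0 1)
  exact pow_le_pow_left₀ (hq0 1) (by rwa [← one_div]) k

/-- One factor with index at least 2 is compared with q 2, and each of the other k-1 with the bound
1/12 on q 1; every step up in an index gains π⁻². -/
theorem prod_le_of_exists_two_le (hq0 : ∀ m, 0 ≤ q m) (hq1 : q 1 ≤ 1 / 12)
    (hq : ∀ m j, q (m + j) ≤ q m / Real.pi ^ (2 * j)) {k : ℕ}
    {n : Fin k → ℕ} (hn1 : ∀ i, 1 ≤ n i) {i₀ : Fin k} (hn : 2 ≤ n i₀) :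
    ∏ i, q (n i) ≤ q 2 / (12 ^ (k - 1) * Real.pi ^ (∑ i, 2 * n i - 2 * k - 2)) := by
  have hπ := Real.pi_pos
  have h0 : q (n i₀) ≤ q 2 / Real.pi ^ (2 * (n i₀ - 2)) := by
    simpa [Nat.add_sub_cancel' hn] using hq 2 (n i₀ - 2)
  have h1 : ∀ i, q (n i) ≤ 1 / 12 * (1 / Real.pi ^ (2 * (n i - 1))) := by
    intro i
    have := hq 1 (n i - 1)
    rw [Nat.add_sub_cancel' (hn1 i)] at this
    refine this.trans ?_
    rw [mul_one_div]
    exact div_le_div_of_nonneg_right hq1 (by positivity)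
  have h2 : ∏ i ∈ Finset.univ.erase i₀, q (n i) ≤
      (1 / 12) ^ (k - 1) * (1 / Real.pi ^ (∑ i ∈ Finset.univ.erase i₀, 2 * (n i - 1))) := by
    refine (Finset.prod_le_prod (fun i _ => hq0 _) fun i _ => h1 i).trans_eq ?_
    rw [Finset.prod_mul_distrib, Finset.prod_const, Finset.card_erase_of_mem (Finset.mem_univ _),
      Finset.card_univ, Fintype.card_fin]
    simp only [one_div, Finset.prod_inv_distrib, Finset.prod_pow_eq_pow_sum]
  -- The truncated subtractions are genuine, as n i₀ ≥ 2 and all other entries are at least 1.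
  have hexp : 2 * (n i₀ - 2) + ∑ i ∈ Finset.univ.erase i₀, 2 * (n i - 1) =
      ∑ i, 2 * n i - 2 * k - 2 := by
    have hs : ∑ i ∈ Finset.univ.erase i₀, 2 * n i =
        ∑ i ∈ Finset.univ.erase i₀, 2 * (n i - 1) + 2 * (k - 1) := by
      have : ∀ i ∈ Finset.univ.erase i₀, 2 * n i = 2 * (n i - 1) + 2 := fun i _ => by
        have := hn1 i
        omega
      rw [Finset.sum_congr rfl this, Finset.sum_add_distrib, Finset.sum_const,
        Finset.card_erase_of_mem (Finset.mem_univ _), Finset.card_univ, Fintype.card_fin,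
        smul_eq_mul, mul_comm]
    have hk : 1 ≤ k := i₀.pos
    rw [← Finset.add_sum_erase _ _ (Finset.mem_univ i₀), hs]
    omega
  rw [← Finset.mul_prod_erase _ _ (Finset.mem_univ i₀)]
  refine (mul_le_mul h0 h2 (Finset.prod_nonneg fun i _ => hq0 _)
    (div_nonneg (hq0 2) (by positivity))).trans_eq ?_
  rw [← hexp, pow_add, one_div_pow]
  field_simp

-- The sum dominates q 1 times the first hypothesis plus q 2 times the second, term by term. The
-- leading terms, for the tuples (1) and (2), keep their exact value; all others are bounded from
-- below.
open Classical in
theorem sum_coeff_nonneg (hq0 : ∀ m, 0 ≤ q m) (hq1 : q 1 ≤ 1 / 12)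
    (hq : ∀ m j, q (m + j) ≤ q m / Real.pi ^ (2 * j)) {ℓ : ℕ} (hℓ : 3 ≤ ℓ)
    (c : (k : ℕ) → (Fin k → ℕ) → ℝ) (hc : ℓ < 5 → c 1 ![2] = 0)
    (h1 : 0 ≤ c 1 ![1] / 2 ^ (ℓ - 2) +
      ∑ k ∈ Finset.Icc 1 ℓ,
        ∑ n ∈ tuples ℓ k with (∀ i, n i = 1) ∧ 3 < k + ∑ i, 2 * n i,
          min 0 (c k n) / (12 ^ (k - 1) * 2 ^ (ℓ - ∑ i, 2 * n i)))
    (h2 : 0 ≤ c 1 ![2] / 2 ^ (ℓ - 4) +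
      ∑ k ∈ Finset.Icc 1 ℓ,
        ∑ n ∈ tuples ℓ k with (∃ i, 2 ≤ n i) ∧ 5 < k + ∑ i, 2 * n i,
          min 0 (c k n) /
            (12 ^ (k - 1) * Real.pi ^ (∑ i, 2 * n i - 2 * k - 2) * 2 ^ (ℓ - ∑ i, 2 * n i))) :
    0 ≤ ∑ k ∈ Finset.Icc 1 ℓ, ∑ n ∈ tuples ℓ k,
      c k n * (∏ i, q (n i)) / 2 ^ (ℓ - ∑ i, 2 * n i) := by
  have hπ := Real.pi_pos
  have h3 := add_nonneg (mul_nonneg (hq0 1) h1) (mul_nonneg (hq0 2) h2)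
  simp only [Finset.sum_filter] at h3
  rw [Finset.sum_sigma', Finset.sum_sigma'] at h3
  rw [Finset.sum_sigma']
  refine h3.trans ?_
  set S := (Finset.Icc 1 ℓ).sigma (tuples ℓ) with hS
  -- Each leading term is spread over S as a sum supported at one index, so that both sides can be
  -- compared summand by summand.
  have hone : q 1 * (c 1 ![1] / 2 ^ (ℓ - 2)) = ∑ p ∈ S,
      if p = (⟨1, ![1]⟩ : Σ k, Fin k → ℕ) then q 1 * (c 1 ![1] / 2 ^ (ℓ - 2)) else 0 := by
    rw [Finset.sum_ite_eq', if_pos]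
    rw [hS, Finset.mem_sigma, Finset.mem_Icc, mem_tuples]
    refine ⟨⟨le_rfl, by dsimp only; omega⟩, by simp, fun i j _ => ?_, by simpa using hℓ⟩
    rw [Subsingleton.elim i j]
  have htwo : q 2 * (c 1 ![2] / 2 ^ (ℓ - 4)) = ∑ p ∈ S,
      if p = (⟨1, ![2]⟩ : Σ k, Fin k → ℕ) then q 2 * (c 1 ![2] / 2 ^ (ℓ - 4)) else 0 := by
    rw [Finset.sum_ite_eq']
    -- For ℓ < 5 the tuple (2) is not in S, and its leading coefficient has to vanish.
    by_cases h5 : ℓ < 5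
    · simp [hc h5]
    · rw [if_pos]
      rw [hS, Finset.mem_sigma, Finset.mem_Icc, mem_tuples]
      refine ⟨⟨le_rfl, by dsimp only; omega⟩, by simp, fun i j _ => ?_, by simpa using h5⟩
      rw [Subsingleton.elim i j]
  rw [mul_add, mul_add, hone, htwo, Finset.mul_sum, Finset.mul_sum, ← Finset.sum_add_distrib,
    ← Finset.sum_add_distrib, ← Finset.sum_add_distrib]
  refine Finset.sum_le_sum ?_
  rintro ⟨k, n⟩ hp
  rw [hS, Finset.mem_sigma, Finset.mem_Icc, mem_tuples] at hp
  obtain ⟨⟨hk, -⟩, hn1, -, -⟩ := hp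
  dsimp only at hk hn1 ⊢
  have hprod : 0 ≤ ∏ i, q (n i) := Finset.prod_nonneg fun i _ => hq0 _
  by_cases hall : ∀ i, n i = 1
  · have hnex : ¬∃ i, 2 ≤ n i := by
      rintro ⟨i, hi⟩
      have := hall i
      omega
    have hsum : ∑ i, 2 * n i = 2 * k := by simp [hall, mul_comm]
    have hne2 : (⟨k, n⟩ : Σ k, Fin k → ℕ) ≠ ⟨1, ![2]⟩ := by
      rintro h
      cases h
      simpa using hall 0
    have hno : ¬((∃ i, 2 ≤ n i) ∧ 5 < k + ∑ i, 2 * n i) := fun h => hnex h.1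
    rw [if_neg hne2, if_neg hno]
    by_cases hlt : 3 < k + ∑ i, 2 * n i
    · have hne1 : (⟨k, n⟩ : Σ k, Fin k → ℕ) ≠ ⟨1, ![1]⟩ := by
        rintro h
        cases h
        simp at hlt
      rw [if_neg hne1, if_pos ⟨hall, hlt⟩]
      simp only [zero_add, mul_zero, add_zero]
      exact min_mul_div_le (by positivity) (by positivity) hprod
        (prod_le_of_all_one hq0 hq1 hk hall) rfl
    -- Here 3k ≤ 3, which leaves only the leading tuple (1).
    · obtain rfl : k = 1 := by omega
      obtain rfl : n = ![1] := by
        funext i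
        rw [hall i, Subsingleton.elim i 0]
        rfl
      have hno' : ¬((∀ i, ![1] i = 1) ∧ 3 < 1 + ∑ i : Fin 1, 2 * ![1] i) := fun h => hlt h.2
      rw [if_pos rfl, if_neg hno']
      simp only [mul_zero, add_zero, Fin.prod_univ_one, Fin.sum_univ_one, Matrix.cons_val_zero,
        mul_one]
      exact le_of_eq (by ring)
  · obtain ⟨i₀, hi₀⟩ : ∃ i, 2 ≤ n i := by
      push Not at hall
      obtain ⟨i, hi⟩ := hall
      have := hn1 i
      exact ⟨i, by omega⟩
    have hne1 : (⟨k, n⟩ : Σ k, Fin k → ℕ) ≠ ⟨1, ![1]⟩ := by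
      rintro h
      cases h
      exact hall fun i => by rw [Subsingleton.elim i 0]; rfl
    have hno : ¬((∀ i, n i = 1) ∧ 3 < k + ∑ i, 2 * n i) := fun h => hall h.1
    rw [if_neg hne1, if_neg hno]
    by_cases hlt : 5 < k + ∑ i, 2 * n i
    · have hne2 : (⟨k, n⟩ : Σ k, Fin k → ℕ) ≠ ⟨1, ![2]⟩ := by
        rintro h
        cases h
        simp at hlt
      rw [if_neg hne2, if_pos ⟨⟨i₀, hi₀⟩, hlt⟩]
      simp only [zero_add, mul_zero]
      exact min_mul_div_le (by positivity) (by positivity) hprod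
        (prod_le_of_exists_two_le hq0 hq1 hq hn1 hi₀) rfl
    -- With k plus this sum at most 5, 3k + 2 ≤ 5 forces k = 1 and then the leading tuple (2).
    · have hge : 2 * k + 2 ≤ ∑ i, 2 * n i := by
        have hrest : ∑ i ∈ Finset.univ.erase i₀, 2 ≤ ∑ i ∈ Finset.univ.erase i₀, 2 * n i :=
          Finset.sum_le_sum fun i _ => by have := hn1 i; omega
        rw [Finset.sum_const, Finset.card_erase_of_mem (Finset.mem_univ _), Finset.card_univ,
          Fintype.card_fin, smul_eq_mul] at hrest
        rw [← Finset.add_sum_erase _ _ (Finset.mem_univ i₀)]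
        omega
      obtain rfl : k = 1 := by omega
      obtain rfl : n = ![2] := by
        funext i
        rw [Fin.sum_univ_one] at hlt
        rw [Subsingleton.elim i₀ 0] at hi₀
        rw [Subsingleton.elim i 0]
        simp only [Matrix.cons_val_zero]
        omega
      have hno' : ¬((∃ i : Fin 1, 2 ≤ ![2] i) ∧ 5 < 1 + ∑ i : Fin 1, 2 * ![2] i) :=
        fun h => hlt h.2
      rw [if_pos rfl, if_neg hno']
      simp only [mul_zero, zero_add, add_zero, Fin.prod_univ_one, Fin.sum_univ_one,
        Matrix.cons_val_zero]
      exact le_of_eq (by ring)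

end Coefficients

theorem IsTournamenton.isSkewKernel {W : unitInterval × unitInterval → ℝ}
    (hW : IsTournamenton W) : IsSkewKernel fun p => W p - 1 / 2 := by
  refine ⟨(BddMeasurable.mk hW.measurable hW.bounded).sub (BddMeasurable.const _), fun x y => ?_⟩
  have := hW.add_swap x y
  linarith

theorem IsTournamenton.abs_sub_half_le {W : unitInterval × unitInterval → ℝ}
    (hW : IsTournamenton W) (p : unitInterval × unitInterval) : |W p - 1 / 2| ≤ 1 / 2 := by
  have h1 := hW.add_swap p.1 p.2
  have h2 := hW.nonneg p
  have h3 := hW.nonneg (p.2, p.1)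
  rw [abs_le]
  constructor <;> linarith

/-- The sign s = γ_C treats both cases at once: after multiplication by s, the cycle term and the
path sum are both nonnegative. -/
theorem IsCycleOrientation.quasirandomForcing {V : Type*} [Fintype V] {C : OrientedGraph V}
    {ℓ : ℕ} (hC : C.IsCycleOrientation ℓ) (hℓ : Even ℓ) {s : ℝ} (hs : s * s = 1)
    (hγ : (C.gamma ℓ : ℝ) = s)
    (h : ∀ U, IsSkewKernel U → (∀ p, |U p| ≤ 1 / 2) →
      0 ≤ ∑ k ∈ Finset.Icc 1 ℓ, ∑ n ∈ tuples ℓ k,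
        s * C.alpha n * (∏ i, pathNorm U (n i)) / 2 ^ (ℓ - ∑ i, 2 * n i)) :
    C.QuasirandomForcing := by
  intro W hW hd
  have hU := hW.isSkewKernel
  have hexp := hC.density_expansion hℓ hU
  simp only [sub_add_cancel] at hexp
  rw [hd, hC.card_edges, hγ] at hexp
  have h0 := h _ hU hW.abs_sub_half_le
  simp only [mul_assoc, mul_div_assoc, ← Finset.mul_sum] at h0 hexp
  have hm : 2 ≤ ℓ / 2 := by
    have := hC.1
    obtain ⟨m, rfl⟩ := hℓ.two_dvd
    omega
  have hnn := density_cycleD_nonneg hU hm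
  have hz : (cycleD (ℓ / 2)).density (fun p => W p - 1 / 2) = 0 := by
    -- Since s² = 1, the cycle density plus the signed path sum equals 0, so each is 0.
    have := congrArg (fun x => s * x) hexp
    rw [mul_add, mul_add, ← mul_assoc s s, hs] at this
    linarith
  filter_upwards [ae_eq_zero_of_density_cycleD hU hm hz] with p hp
  simp only [Pi.zero_apply] at hp
  linarith

end OrientedGraph

/-! ### The main theorem -/

open Classical in
theorem mainTheorem7 {V : Type*} [Fintype V] (C : OrientedGraph V) (ℓ : ℕ) (hℓ : Even ℓ)
    (hC : C.IsCycleOrientation ℓ) :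
    (C.gamma ℓ = 1 →
      0 ≤ (C.alpha ![1] : ℝ) / 2 ^ (ℓ - 2) +
        ∑ k ∈ Finset.Icc 1 ℓ,
          ∑ n ∈ OrientedGraph.tuples ℓ k with (∀ i, n i = 1) ∧ 3 < k + ∑ i, 2 * n i,
            min 0 (C.alpha n : ℝ) / (12 ^ (k - 1) * 2 ^ (ℓ - ∑ i, 2 * n i)) →
      0 ≤ (C.alpha ![2] : ℝ) / 2 ^ (ℓ - 4) +
        ∑ k ∈ Finset.Icc 1 ℓ,
          ∑ n ∈ OrientedGraph.tuples ℓ k with (∃ i, 2 ≤ n i) ∧ 5 < k + ∑ i, 2 * n i,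
            min 0 (C.alpha n : ℝ) /
              (12 ^ (k - 1) * Real.pi ^ (∑ i, 2 * n i - 2 * k - 2) *
                2 ^ (ℓ - ∑ i, 2 * n i)) →
      C.QuasirandomForcing) ∧
    (C.gamma ℓ = -1 →
      (C.alpha ![1] : ℝ) / 2 ^ (ℓ - 2) +
        ∑ k ∈ Finset.Icc 1 ℓ,
          ∑ n ∈ OrientedGraph.tuples ℓ k with (∀ i, n i = 1) ∧ 3 < k + ∑ i, 2 * n i,
            max 0 (C.alpha n : ℝ) / (12 ^ (k - 1) * 2 ^ (ℓ - ∑ i, 2 * n i)) ≤ 0 →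
      (C.alpha ![2] : ℝ) / 2 ^ (ℓ - 4) +
        ∑ k ∈ Finset.Icc 1 ℓ,
          ∑ n ∈ OrientedGraph.tuples ℓ k with (∃ i, 2 ≤ n i) ∧ 5 < k + ∑ i, 2 * n i,
            max 0 (C.alpha n : ℝ) /
              (12 ^ (k - 1) * Real.pi ^ (∑ i, 2 * n i - 2 * k - 2) *
                2 ^ (ℓ - ∑ i, 2 * n i)) ≤ 0 →
      C.QuasirandomForcing) := by
  have h3 := hC.1
  have hα : ℓ < 5 → C.alpha ![2] = 0 := fun h =>
    OrientedGraph.alpha_eq_zero (by rw [hC.card_eq]; simpa using h)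
  constructor
  · intro hγ h1 h2
    refine hC.quasirandomForcing hℓ (one_mul 1) (by simp [hγ]) fun U hU hU2 => ?_
    simp only [one_mul]
    exact OrientedGraph.sum_coeff_nonneg OrientedGraph.pathNorm_nonneg
      (OrientedGraph.pathNorm_one_le hU hU2) (OrientedGraph.pathNorm_add_le hU hU2) h3
      (fun _ n => (C.alpha n : ℝ)) (fun h => by simp [hα h]) h1 h2
  · intro hγ h1 h2
    refine hC.quasirandomForcing hℓ (s := -1) (by norm_num) (by simp [hγ]) fun U hU hU2 => ?_
    -- Negating all coefficients turns the maxima into minima and reduces γ_C = -1 to the same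
    -- estimate.
    have hmin : ∀ x : ℝ, min 0 (-x) = -max 0 x := fun x => by
      rw [← min_neg_neg, neg_zero]
    refine OrientedGraph.sum_coeff_nonneg OrientedGraph.pathNorm_nonneg
      (OrientedGraph.pathNorm_one_le hU hU2) (OrientedGraph.pathNorm_add_le hU hU2) h3
      (fun _ n => -1 * (C.alpha n : ℝ)) (fun h => by simp [hα h]) ?_ ?_
    · simp only [neg_one_mul, hmin, neg_div, Finset.sum_neg_distrib]
      linarith
    · simp only [neg_one_mul, hmin, neg_div, Finset.sum_neg_distrib]
      linarith
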